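/- Let $N\ge 8$ be even, $L$ odd, $r=\lceil N/L\rceil\ge 5$ and $w=e^{2\pi \mathbf{i}L/N}$. Signals $\mathbf z\in\mathbb C^N$ are extended $N$-periodically; $\hat z_k=\sum_{n=0}^{N-1}z_ne^{-2\pi \mathbf{i}kn/N}$ is the DFT. A signal is *analytic* if it is $A\mathbf x$ for some $\mathbf x\in\mathbb R^N$, where $\widehat{A\mathbf x}_k$ is $\hat x_k$ for $k\in\{0,N/2\}$, $2\hat x_k$ for $1\le k\le N/2-1$, and $0$ for $N/2<k\le N-1$. A property holds for *generic* analytic signals if there is a nonzero real polynomial $P$ in $N$ variables such that it holds for $A\mathbf x$ whenever $P(\mathbf x)\ne0$. The $[N,L]$-FROG measurements of $\mathbf z$ are $$|\hat y_{k,m}|^2=\Big|\sum_{n=0}^{N-1}z_nz_{n+mL}e^{-2\pi \mathbf{i}kn/N}\Big|^2,\qquad 0\le k\le N-1,\ 0\le m\le r-1 .$$ The *ambiguity* consists of the compositions of $\mathbf z\mapsto-\mathbf z$, integer translations $z_n\mapsto z_{n+l}$ ($l\in\mathbb Z$), and the reflection $z_n\mapsto\overline{z_{-n}}$. *Prescribed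 measurements.* Call a choice of shifts in $\{0,\dots,r-1\}$ admissible if it consists of - five distinct $i_2^{(1)}=0,i_2^{(2)},\dots,i_2^{(5)}$ with $w^{2i_2^{(q)}}\ne-1$ for all $q$ and $\frac{w^{i_2^{(2)}}}{1+w^{2i_2^{(2)}}}\ne\frac12$; - $i_3\ge1$ with $w^{3i_3}\ne-1$ and $\frac{w^{i_3}+w^{2i_3}}{1+w^{3i_3}}\ne1$; - for each $4\le k\le N/2$, three distinct $i_k^{(1)}=0,i_k^{(2)},i_k^{(3)}$ with $w^{ki_k^{(p)}}\ne-1$ for all $p$ and $i_k^{(2)}+i_k^{(3)}\ne r$. The prescribed measurements are $|\hat y_{k,m}|^2$ for $(k,m)$ equal to $(0,0),(0,1),(1,0)$, $(2,i_2^{(q)})$ ($1\le q\le5$), $(3,0),(3,i_3)$, and $(k,i_k^{(p)})$ ($4\le k\le N/2$, $1\le p\le3$). *Algorithm* (it uses only the prescribed measurements). 1. If $|\hat y_{0,1}|=0$, put $u_0=\sqrt{N|\hat y_{0,0}|/2}$. Otherwise put $t_0=\sqrt{N(|\hat y_{0,0}|+|\hat y_{0,1}|)/2}$ and $t_1=\frac{N|\hat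 y_{1,0}|}{2t_0}$; if some $c\in\mathbb C$ satisfies $\frac1N|t_0c(1+w^{2i_2^{(q)}})+t_1^2w^{i_2^{(q)}}|=|\hat y_{2,i_2^{(q)}}|$ for $q=1,\dots,5$, put $u_0=t_0$, and if not, put $u_0=\sqrt{N(|\hat y_{0,0}|-|\hat y_{0,1}|)/2}$. 2. Put $u_1=\frac{N|\hat y_{1,0}|}{2|u_0|}$. Let $E_{k,m}$ denote the equation $|\hat y_{k,m}|=\frac1N\big|\sum_{l=0}^ku_lu_{k-l}w^{lm}\big|$. Choose a solution $u_2$ of $E_{2,0},E_{2,i_2^{(2)}}$; then a solution $(u_3,u_4)$ of $E_{3,0},E_{3,i_3},E_{4,i_4^{(p)}}$ ($p=1,2,3$); then, successively for $j=5,\dots,N/2$, a solution $u_j$ of $E_{j,i_j^{(p)}}$ ($p=1,2,3$). 3. The output is the signal $\mathring{\mathbf z}$ with $\hat{\mathring z}_k=u_ke^{-\mathbf{i}\frac{2k}N\arg(u_{N/2})}$ for $0\le k\le N/2$ and $\hat{\mathring z}_k=0$ for $N/2<k\le N-1$. **Theorem.** For every admissible choice of shifts the prescribed measurements are $3N/2+1$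 in number. Moreover, generic analytic signals $\mathbf z\in\mathbb C^N$ with $\hat z_0\ne0$ and $\hat z_1\ne0$ have, for every admissible choice of shifts (the polynomial $P$ depending only on $N$ and $L$), the following properties. Run on the prescribed measurements of $\mathbf z$, the algorithm can choose $u_2$, and after any choice of $u_2$ all further steps can be carried out in exactly one way. Every output $\mathring{\mathbf z}$ equals $\mathbf z$ up to the ambiguity, and the analytic signals with the same $[N,L]$-FROG measurements as $\mathbf z$ (for all $0\le k\le N-1$, $0\le m\le r-1$) are exactly those that equal $\mathring{\mathbf z}$ up to the ambiguity. In particular, every analytic signal with the same $3N/2+1$ prescribed measurements as $\mathbf z$ equals $\mathbf z$ up to the ambiguity. -/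

import Mathlib

noncomputable section

namespace FROG

/-! Signals of length `N` are functions `ZMod N → ℂ` (so they are `N`-periodic), and the DFT is
`ZMod.dft z k = ∑ n, z n * exp (-2 π i k n / N)`. -/

/-- The number `r = ⌈N / L⌉` of shifts. -/
def numShifts (N L : ℕ) : ℕ := ⌈(N : ℝ) / (L : ℝ)⌉₊

/-- The `[N, L]`-FROG measurement `|ŷ_{k,m}|²` of `z`, the squared modulus of the DFT at `k` of the
product `y_{n,m} = z_n z_{n+mL}`. -/
def measurement {N : ℕ} [NeZero N] (L : ℕ) (z : ZMod N → ℂ) (k m : ℕ) : ℝ :=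
  ‖ZMod.dft (fun n : ZMod N => z n * z (n + ((m * L : ℕ) : ZMod N))) (k : ZMod N)‖ ^ 2

/-- The factor by which the DFT of a real signal is multiplied to get that of its analytic signal:
`1` at frequencies `0` and `N/2`, `2` strictly between them, `0` beyond `N/2`. -/
def analyticFactor {N : ℕ} (k : ZMod N) : ℂ :=
  if k.val = 0 then 1
  else if 2 * k.val < N then 2
  else if 2 * k.val = N then 1
  else 0

/-- The analytic signal `Ax` of a real signal `x`. -/
def analyticSignal {N : ℕ} [NeZero N] (x : ZMod N → ℝ) : ZMod N → ℂ :=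
  ZMod.dft.symm (fun k : ZMod N =>
    analyticFactor k * ZMod.dft (fun n : ZMod N => ((x n : ℝ) : ℂ)) k)

/-- `z` is analytic if it is the analytic signal of some real signal. -/
def IsAnalytic {N : ℕ} [NeZero N] (z : ZMod N → ℂ) : Prop :=
  ∃ x : ZMod N → ℝ, z = analyticSignal x

/-- A property holds for generic analytic signals if it holds for all `Ax` with `x ∈ ℝ^N` outside
the zero set of some nonzero real polynomial. Since `x ↦ Ax` is a real-linear bijection from `ℝ^N`
onto the analytic signals, this is genericity in the real vector space of analytic signals. -/
def ForGenericAnalytic (N : ℕ) [NeZero N] (Q : (ZMod N → ℂ) → Prop) : Prop :=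
  ∃ P : MvPolynomial (ZMod N) ℝ, P ≠ 0 ∧
    ∀ x : ZMod N → ℝ, MvPolynomial.eval x P ≠ 0 → Q (analyticSignal x)

/-- The translation by an integer `l`; its DFT is `k ↦ ẑ_k exp (2 π i k l / N)`. -/
def translate {N : ℕ} (l : ℤ) (z : ZMod N → ℂ) : ZMod N → ℂ :=
  fun n => z (n + (l : ZMod N))

/-- The reflection, with entries the complex conjugates of `z_{-n}`. -/
def reflect {N : ℕ} (z : ZMod N → ℂ) : ZMod N → ℂ :=
  fun n => (starRingEnd ℂ) (z (-n))

/-- `z'` arises from `z` by a composition of `π`-rotation (`z ↦ -z`), integer translation and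
reflection. -/
def SameUpToAmbiguity {N : ℕ} (z' z : ZMod N → ℂ) : Prop :=
  ∃ (s : ℂ) (l : ℤ), (s = 1 ∨ s = -1) ∧
    (z' = s • translate l z ∨ z' = s • translate l (reflect z))

/-- The root of unity `w = exp (2 π i L / N)`, for which
`ŷ_{k,m} = (1/N) ∑_l ẑ_l ẑ_{k-l} w^{lm}`; it is `exp (2 π i / r)` when `L` divides `N`. -/
def rootW (N L : ℕ) : ℂ :=
  Complex.exp (2 * (Real.pi : ℂ) * Complex.I * (L : ℂ) / (N : ℂ))

/-- A choice of shifts: `i2 q` is `i_2^{(q+1)}`, `i3` is `i_3`, and `ik k p` is `i_k^{(p+1)}`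
(used for `4 ≤ k ≤ N/2` only). -/
structure Shifts where
  i2 : Fin 5 → ℕ
  i3 : ℕ
  ik : ℕ → Fin 3 → ℕ

/-- The requirements on the shifts of the prescribed measurements. -/
structure Shifts.Admissible (N L : ℕ) (I : Shifts) : Prop where
  i2_lt : ∀ q, I.i2 q < numShifts N L
  i2_injective : Function.Injective I.i2
  i2_first : I.i2 0 = 0
  i2_ne : ∀ q, rootW N L ^ (2 * I.i2 q) ≠ -1
  i2_second : rootW N L ^ (I.i2 1) / (1 + rootW N L ^ (2 * I.i2 1)) ≠ 1 / 2
  i3_pos : 1 ≤ I.i3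
  i3_lt : I.i3 < numShifts N L
  i3_ne : rootW N L ^ (3 * I.i3) ≠ -1
  i3_ratio : (rootW N L ^ I.i3 + rootW N L ^ (2 * I.i3)) / (1 + rootW N L ^ (3 * I.i3)) ≠ 1
  ik_lt : ∀ k, 4 ≤ k → k ≤ N / 2 → ∀ p, I.ik k p < numShifts N L
  ik_injective : ∀ k, 4 ≤ k → k ≤ N / 2 → Function.Injective (I.ik k)
  ik_first : ∀ k, 4 ≤ k → k ≤ N / 2 → I.ik k 0 = 0
  ik_ne : ∀ k, 4 ≤ k → k ≤ N / 2 → ∀ p, rootW N L ^ (k * I.ik k p) ≠ -1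
  ik_sum : ∀ k, 4 ≤ k → k ≤ N / 2 → I.ik k 1 + I.ik k 2 ≠ numShifts N L

/-- The set of the pairs `(k, m)` at which the prescribed measurements are taken. -/
def Shifts.positions (N : ℕ) (I : Shifts) : Finset (ℕ × ℕ) :=
  {(0, 0), (0, 1), (1, 0)} ∪ Finset.univ.image (fun q : Fin 5 => (2, I.i2 q)) ∪
    {(3, 0), (3, I.i3)} ∪
    (Finset.Icc 4 (N / 2)).biUnion
      (fun k => Finset.univ.image (fun p : Fin 3 => (k, I.ik k p)))

/-! In the algorithm the data are `b k m = |ŷ_{k,m}|²`, of which only the entries at the prescribed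
positions are read; `√(b k m)` is `|ŷ_{k,m}|`. -/

/-- The output `ẑ₀` of the first part of the algorithm, which finds the modulus of `ẑ₀`. -/
def firstEntry (N L : ℕ) (I : Shifts) (b : ℕ → ℕ → ℝ) : ℝ :=
  open Classical in
  if √(b 0 1) = 0 then √(N * √(b 0 0) / 2)
  else
    let t₀ : ℝ := √(N * (√(b 0 0) + √(b 0 1)) / 2)
    let t₁ : ℝ := N * √(b 1 0) / (2 * t₀)
    if ∃ c : ℂ, ∀ q : Fin 5,
        1 / (N : ℝ) * ‖(t₀ : ℂ) * c * (1 + rootW N L ^ (2 * I.i2 q))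
          + (t₁ : ℂ) ^ 2 * rootW N L ^ (I.i2 q)‖ = √(b 2 (I.i2 q))
    then t₀
    else √(N * (√(b 0 0) - √(b 0 1)) / 2)

/-- The equation `|ŷ_{k,m}| = (1/N) |∑_{l=0}^{k} u_l u_{k-l} w^{lm}|` for the entries of `u`. -/
def Fits (N L : ℕ) (b : ℕ → ℕ → ℝ) (u : ℕ → ℂ) (k m : ℕ) : Prop :=
  √(b k m) =
    1 / (N : ℝ) * ‖∑ l ∈ Finset.range (k + 1), u l * u (k - l) * rootW N L ^ (l * m)‖

/-- `u = (u_0, ..., u_n, 0, 0, ...)` is a possible state of the second part of the algorithm at the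
moment when the entries up to index `n` have been computed. This part starts from `u_0` (the output
of the first part) and `u_1`; its first step chooses a solution `u_2` of two equations, its second
step takes a solution `(u_3, u_4)` of five equations, and its third step takes, successively for
`j = 5, 6, ...`, a solution `u_j` of three equations. So the meaningful values are
`n = 2, 4, 5, ..., N/2`. -/
structure IsState (N L : ℕ) (I : Shifts) (b : ℕ → ℕ → ℝ) (n : ℕ) (u : ℕ → ℂ) : Prop where
  entry_zero : u 0 = ((firstEntry N L I b : ℝ) : ℂ)
  entry_one : u 1 = ((N * √(b 1 0) / (2 * |firstEntry N L I b|) : ℝ) : ℂ)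
  step_one : Fits N L b u 2 0 ∧ Fits N L b u 2 (I.i2 1)
  step_two : 4 ≤ n → Fits N L b u 3 0 ∧ Fits N L b u 3 I.i3 ∧ ∀ p, Fits N L b u 4 (I.ik 4 p)
  step_three : ∀ j, 5 ≤ j → j ≤ n → ∀ p, Fits N L b u j (I.ik j p)
  tail : ∀ j, n < j → u j = 0

/-- The last part of the algorithm: from `u = (u_0, ..., u_{N/2}, 0, ...)` the signal with DFT
`k ↦ u_k exp (-i (2k/N) arg u_{N/2})`. -/
def finalSignal (N : ℕ) [NeZero N] (u : ℕ → ℂ) : ZMod N → ℂ :=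
  ZMod.dft.symm (fun k : ZMod N =>
    u k.val * Complex.exp
      (-(Complex.I * (2 * (k.val : ℂ) / (N : ℂ)) * ((Complex.arg (u (N / 2)) : ℝ) : ℂ))))

/-- `o` is an output of the whole algorithm on the data `b`. (The algorithm makes a choice between
solutions, hence a relation.) -/
def IsOutput (N L : ℕ) [NeZero N] (I : Shifts) (b : ℕ → ℕ → ℝ) (o : ZMod N → ℂ) : Prop :=
  ∃ u : ℕ → ℂ, IsState N L I b (N / 2) u ∧ o = finalSignal N u

end FROG

end

/-
The ambiguity allows one to normalize the phases so that the spectrum `u` of the signal has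
`u₀, u₁ > 0`. The `k`-th sums then factor as

  `∑ l, u_l u_{k-l} w^{lm} = (1 + w^{km}) / 2 * (2 u₀ u_k + c_{k,m})`

with `c_{k,m}` depending on `u₁, …, u_{k-1}` only, so that `|ŷ_{k,m}|` gives the distance of
`2 u₀ u_k` from the point `-c_{k,m}`. For `k ≥ 4` three shifts generically give three non-collinear
points, and these distances determine `u_k`. For `k = 2` and `k = 3` the points `-c_{k,m}` are
collinear, and `u_k` is determined up to a reflection in a line. For `k = 2` this is complex
conjugation, which corresponds to the reflection of the signal; for `k = 3` the reflected value is
generically incompatible with the three equations at `k = 4`. Each genericity condition is the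
nonvanishing of a polynomial in the real signal, and is seen to be nontrivial by an explicit
spectrum.
-/

noncomputable section


namespace FROG

open ZMod
open scoped ComplexConjugate

/-! ### The ambiguity group -/

section Ambiguity

variable {N : ℕ}

lemma translate_zero (z : ZMod N → ℂ) : translate 0 z = z := by
  ext n; simp [translate]

lemma translate_smul (l : ℤ) (s : ℂ) (z : ZMod N → ℂ) :
    translate l (s • z) = s • translate l z := rfl

lemma translate_translate (l m : ℤ) (z : ZMod N → ℂ) :
    translate l (translate m z) = translate (l + m) z := by
  ext n; simp [translate, add_assoc]

lemma reflect_reflect (z : ZMod N → ℂ) : reflect (reflect z) = z := by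
  ext n; simp [reflect]

lemma reflect_smul (s : ℂ) (z : ZMod N → ℂ) : reflect (s • z) = conj s • reflect z := by
  ext n; simp [reflect]

lemma reflect_translate (l : ℤ) (z : ZMod N → ℂ) :
    reflect (translate l z) = translate (-l) (reflect z) := by
  ext n; simp only [reflect, translate]; congr 2; push_cast; ring

lemma conj_sign {s : ℂ} (hs : s = 1 ∨ s = -1) : conj s = s := by
  rcases hs with rfl | rfl <;> simp

lemma norm_sign {s : ℂ} (hs : s = 1 ∨ s = -1) : ‖s‖ = 1 := by
  rcases hs with rfl | rfl <;> simp

lemma sign_mul_self {s : ℂ} (hs : s = 1 ∨ s = -1) : s * s = 1 := mul_self_eq_one_iff.mpr hs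

lemma sign_mul {s t : ℂ} (hs : s = 1 ∨ s = -1) (ht : t = 1 ∨ t = -1) :
    s * t = 1 ∨ s * t = -1 := by
  rcases hs with rfl | rfl <;> simpa [neg_eq_iff_eq_neg, or_comm] using ht

namespace SameUpToAmbiguity

variable {x y z : ZMod N → ℂ}

lemma translate (h : SameUpToAmbiguity x z) (l : ℤ) :
    SameUpToAmbiguity (translate l x) z := by
  obtain ⟨s, m, hs, rfl | rfl⟩ := h
  · exact ⟨s, l + m, hs, .inl (by rw [translate_smul, translate_translate])⟩
  · exact ⟨s, l + m, hs, .inr (by rw [translate_smul, translate_translate])⟩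

lemma reflect (h : SameUpToAmbiguity x z) : SameUpToAmbiguity (reflect x) z := by
  obtain ⟨s, m, hs, rfl | rfl⟩ := h
  · exact ⟨s, -m, hs, .inr (by rw [reflect_smul, conj_sign hs, reflect_translate])⟩
  · exact ⟨s, -m, hs, .inl (by
      rw [reflect_smul, conj_sign hs, reflect_translate, reflect_reflect])⟩

lemma smul (h : SameUpToAmbiguity x z) {t : ℂ} (ht : t = 1 ∨ t = -1) :
    SameUpToAmbiguity (t • x) z := by
  obtain ⟨s, m, hs, h⟩ := h
  refine ⟨t * s, m, sign_mul ht hs, h.imp ?_ ?_⟩ <;> exact fun hx => by rw [hx, smul_smul]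

lemma trans (hxy : SameUpToAmbiguity x y) (hyz : SameUpToAmbiguity y z) :
    SameUpToAmbiguity x z := by
  obtain ⟨s, l, hs, rfl | rfl⟩ := hxy
  · exact (hyz.translate l).smul hs
  · exact (hyz.reflect.translate l).smul hs

lemma symm (h : SameUpToAmbiguity x y) : SameUpToAmbiguity y x := by
  obtain ⟨s, l, hs, rfl | rfl⟩ := h
  · exact ⟨s, -l, hs, .inl (by
      rw [translate_smul, translate_translate, smul_smul, sign_mul_self hs, neg_add_cancel,
        translate_zero, one_smul])⟩
  · exact ⟨s, l, hs, .inr (by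
      rw [reflect_smul, conj_sign hs, reflect_translate, translate_smul, translate_translate,
        smul_smul, sign_mul_self hs, add_neg_cancel, translate_zero, one_smul, reflect_reflect])⟩

end SameUpToAmbiguity

end Ambiguity

/-! ### Fourier transforms and invariance of the measurements -/

section Fourier

variable {N : ℕ} [NeZero N]

lemma rootW_pow_eq_stdAddChar (L n : ℕ) :
    rootW N L ^ n = stdAddChar ((n * L : ℕ) : ZMod N) := by
  rw [← Int.cast_natCast (n * L), stdAddChar_coe, rootW, ← Complex.exp_nat_mul]
  congr 1
  push_cast
  ring

lemma dft_comp_add (z : ZMod N → ℂ) (t k : ZMod N) :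
    dft (fun n => z (n + t)) k = stdAddChar (t * k) * dft z k := by
  rw [dft_apply, dft_apply, Finset.mul_sum]
  refine Fintype.sum_equiv (Equiv.addRight t) _ _ fun n => ?_
  simp only [Equiv.coe_addRight, smul_eq_mul]
  rw [← mul_assoc, ← AddChar.map_add_eq_mul]
  congr 2
  ring

lemma dft_translate (l : ℤ) (z : ZMod N → ℂ) (k : ZMod N) :
    dft (translate l z) k = stdAddChar ((l : ZMod N) * k) * dft z k :=
  dft_comp_add z _ k

lemma dft_conj (z : ZMod N → ℂ) (k : ZMod N) :
    dft (fun n => conj (z n)) k = conj (dft z (-k)) := by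
  simp only [dft_apply, smul_eq_mul, map_sum, map_mul, ← AddChar.map_neg_eq_conj, mul_neg, neg_neg]

lemma dft_reflect (z : ZMod N → ℂ) (k : ZMod N) : dft (reflect z) k = conj (dft z k) := by
  have h := dft_conj (fun j => z (-j)) k
  simp only [dft_comp_neg, neg_neg] at h
  exact h

lemma dft_mul_comp_add (z : ZMod N → ℂ) (t k : ZMod N) :
    dft (fun n => z n * z (n + t)) k =
      (N : ℂ)⁻¹ * ∑ l : ZMod N, dft z l * dft z (k - l) * stdAddChar (l * t) := by
  have hz (n : ZMod N) : z (n + t) = (N : ℂ)⁻¹ * ∑ l, stdAddChar (l * (n + t)) * dft z l := by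
    simpa using invDFT_apply (dft z) (n + t)
  have hchar (n l : ZMod N) :
      (stdAddChar (-(n * (k - l))) : ℂ) = stdAddChar (-(n * k)) * stdAddChar (l * n) := by
    rw [← AddChar.map_add_eq_mul]; congr 1; ring
  rw [dft_apply]
  simp only [hz, smul_eq_mul, Finset.mul_sum]
  rw [Finset.sum_comm]
  refine Finset.sum_congr rfl fun l _ => ?_
  simp only [dft_apply z (k - l), smul_eq_mul, Finset.mul_sum, Finset.sum_mul]
  refine Finset.sum_congr rfl fun n _ => ?_
  rw [hchar, mul_add, AddChar.map_add_eq_mul]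
  ring

lemma measurement_translate (L : ℕ) (l : ℤ) (z : ZMod N → ℂ) (k m : ℕ) :
    measurement L (translate l z) k m = measurement L z k m := by
  have hprod : (fun n : ZMod N => translate l z n * translate l z (n + ((m * L : ℕ) : ZMod N))) =
      translate l fun n => z n * z (n + ((m * L : ℕ) : ZMod N)) := by
    ext n; simp only [translate]; rw [add_right_comm]
  rw [measurement, hprod, dft_translate, norm_mul, AddChar.norm_apply, one_mul, measurement]

lemma measurement_reflect (L : ℕ) (z : ZMod N → ℂ) (k m : ℕ) :
    measurement L (reflect z) k m = measurement L z k m := by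
  set t : ZMod N := ((m * L : ℕ) : ZMod N) with ht
  have hprod : (fun n : ZMod N => reflect z n * reflect z (n + t)) =
      fun n => reflect (fun n => z n * z (n + t)) (n + t) := by
    ext n
    simp only [reflect, map_mul]
    rw [mul_comm, show -(n + t) + t = -n by ring]
  rw [measurement, ← ht, hprod, dft_comp_add, norm_mul, AddChar.norm_apply, one_mul, dft_reflect,
    RCLike.norm_conj, measurement]

lemma measurement_smul (L : ℕ) {s : ℂ} (hs : ‖s‖ = 1) (z : ZMod N → ℂ) (k m : ℕ) :
    measurement L (s • z) k m = measurement L z k m := by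
  have hprod : (fun n : ZMod N => (s • z) n * (s • z) (n + ((m * L : ℕ) : ZMod N))) =
      (s * s) • fun n => z n * z (n + ((m * L : ℕ) : ZMod N)) := by
    ext n; simp only [Pi.smul_apply, smul_eq_mul]; ring
  rw [measurement, hprod, _root_.map_smul, Pi.smul_apply, norm_smul, norm_mul, hs, one_mul,
    one_mul, measurement]

lemma SameUpToAmbiguity.measurement_eq {x y : ZMod N → ℂ} (h : SameUpToAmbiguity x y)
    (L k m : ℕ) : measurement L x k m = measurement L y k m := by
  obtain ⟨s, l, hs, rfl | rfl⟩ := h <;>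
  simp only [measurement_smul L (norm_sign hs), measurement_translate, measurement_reflect]

end Fourier

/-! ### Spectra of analytic signals -/

section Analytic

variable {N : ℕ} [NeZero N]

/-- The sequences that are the DFT of an analytic signal (see `isAnalytic_iff`): real at the
frequencies `0` and `N / 2` and zero beyond `N / 2`. -/
structure IsAnalyticSpectrum (a : ZMod N → ℂ) : Prop where
  conj_zero : conj (a 0) = a 0
  conj_half : ∀ k : ZMod N, 2 * k.val = N → conj (a k) = a k
  tail : ∀ k : ZMod N, N < 2 * k.val → a k = 0

lemma neg_eq_self_of_two_mul_val {k : ZMod N} (hk : 2 * k.val = N) : -k = k := by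
  rw [neg_eq_iff_add_eq_zero, ← ZMod.natCast_zmod_val k, ← Nat.cast_add, ← two_mul, hk,
    ZMod.natCast_self]

lemma conj_dft_ofReal (x : ZMod N → ℝ) (k : ZMod N) :
    conj (dft (fun n => (x n : ℂ)) k) = dft (fun n => (x n : ℂ)) (-k) := by
  have h := dft_conj (fun n => (x n : ℂ)) (-k)
  simp only [Complex.conj_ofReal, neg_neg] at h
  exact h.symm

lemma isAnalyticSpectrum_dft_analyticSignal (x : ZMod N → ℝ) :
    IsAnalyticSpectrum (dft (analyticSignal x)) := by
  rw [analyticSignal, LinearEquiv.apply_symm_apply]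
  refine ⟨?_, fun k hk => ?_, fun k hk => ?_⟩
  · rw [map_mul, conj_dft_ofReal, neg_zero]
    simp [analyticFactor]
  · have h0 : k.val ≠ 0 := by have := NeZero.ne N; lia
    rw [map_mul, conj_dft_ofReal, neg_eq_self_of_two_mul_val hk]
    simp [analyticFactor, h0, hk]
  · simp [analyticFactor, show k.val ≠ 0 by lia, show ¬ 2 * k.val < N by lia, hk.ne']

lemma analyticSignal_re {z : ZMod N → ℂ} (h : IsAnalyticSpectrum (dft z)) :
    analyticSignal (fun n => (z n).re) = z := by
  have hre : (fun n : ZMod N => ((z n).re : ℂ)) = (2 : ℂ)⁻¹ • (z + fun n => conj (z n)) := by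
    ext n
    simp only [Pi.smul_apply, Pi.add_apply, smul_eq_mul, Complex.add_conj]
    push_cast
    ring
  rw [analyticSignal, LinearEquiv.symm_apply_eq]
  funext k
  rw [hre, _root_.map_smul, map_add, Pi.smul_apply, Pi.add_apply, dft_conj, smul_eq_mul,
    analyticFactor]
  split_ifs with h0 h1 h2
  · obtain rfl : k = 0 := (ZMod.val_eq_zero k).mp h0
    rw [neg_zero, h.conj_zero]; ring
  · have : NeZero k := ⟨fun hk => h0 (by rw [hk, ZMod.val_zero])⟩
    rw [h.tail (-k) (by have := ZMod.val_neg_of_ne_zero k; lia), map_zero]; ring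
  · rw [neg_eq_self_of_two_mul_val h2, h.conj_half k h2]; ring
  · rw [h.tail k (by lia)]; ring

lemma isAnalytic_iff (z : ZMod N → ℂ) : IsAnalytic z ↔ IsAnalyticSpectrum (dft z) := by
  refine ⟨?_, fun h => ⟨_, (analyticSignal_re h).symm⟩⟩
  rintro ⟨x, rfl⟩
  exact isAnalyticSpectrum_dft_analyticSignal x

namespace IsAnalytic

variable {z : ZMod N → ℂ}

lemma translate (h : IsAnalytic z) (l : ℤ) : IsAnalytic (translate l z) := by
  rw [isAnalytic_iff] at *
  refine ⟨?_, fun k hk => ?_, fun k hk => ?_⟩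
  · rw [dft_translate]; simp [h.conj_zero]
  · rw [dft_translate, map_mul, ← AddChar.map_neg_eq_conj, ← mul_neg,
      neg_eq_self_of_two_mul_val hk, h.conj_half k hk]
  · rw [dft_translate, h.tail k hk, mul_zero]

lemma reflect (h : IsAnalytic z) : IsAnalytic (reflect z) := by
  rw [isAnalytic_iff] at *
  refine ⟨?_, fun k hk => ?_, fun k hk => ?_⟩
  · rw [dft_reflect, h.conj_zero, h.conj_zero]
  · rw [dft_reflect, h.conj_half k hk, h.conj_half k hk]
  · rw [dft_reflect, h.tail k hk, map_zero]

lemma smul (h : IsAnalytic z) {s : ℂ} (hs : conj s = s) : IsAnalytic (s • z) := by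
  rw [isAnalytic_iff] at *
  rw [_root_.map_smul]
  refine ⟨?_, fun k hk => ?_, fun k hk => ?_⟩
  · simp only [Pi.smul_apply, smul_eq_mul, map_mul, hs, h.conj_zero]
  · simp only [Pi.smul_apply, smul_eq_mul, map_mul, hs, h.conj_half k hk]
  · simp only [Pi.smul_apply, smul_eq_mul, h.tail k hk, mul_zero]

end IsAnalytic

lemma SameUpToAmbiguity.isAnalytic {x y : ZMod N → ℂ} (h : SameUpToAmbiguity x y)
    (hy : IsAnalytic y) : IsAnalytic x := by
  obtain ⟨s, l, hs, rfl | rfl⟩ := h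
  · exact (hy.translate l).smul (conj_sign hs)
  · exact (hy.reflect.translate l).smul (conj_sign hs)

end Analytic

/-! ### The measurements of an analytic signal in terms of its spectrum -/

section Measurement

variable {N : ℕ} [NeZero N] {z : ZMod N → ℂ}

/-- The DFT coefficients of a signal, indexed by natural numbers so that the sums over
`0 ≤ l ≤ k` of the algorithm can be written. -/
def coeff (z : ZMod N → ℂ) (k : ℕ) : ℂ := dft z (k : ZMod N)

lemma coeff_eq_zero (hz : IsAnalytic z) {k : ℕ} (hk : N / 2 < k) (hkN : k < N) :
    coeff z k = 0 :=
  ((isAnalytic_iff z).mp hz).tail _ (by rw [ZMod.val_cast_of_lt hkN]; lia)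

lemma conj_coeff_zero (hz : IsAnalytic z) : conj (coeff z 0) = coeff z 0 := by
  simpa [coeff] using ((isAnalytic_iff z).mp hz).conj_zero

lemma conj_coeff_half (hz : IsAnalytic z) (hN : Even N) :
    conj (coeff z (N / 2)) = coeff z (N / 2) := by
  refine ((isAnalytic_iff z).mp hz).conj_half _ ?_
  rw [ZMod.val_cast_of_lt (Nat.div_lt_self (NeZero.pos N) one_lt_two),
    Nat.two_mul_div_two_of_even hN]

lemma sum_univ_eq_sum_range (f : ZMod N → ℂ) :
    ∑ l, f l = ∑ l ∈ Finset.range N, f (l : ZMod N) :=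
  Finset.sum_bij (fun l _ => l.val) (fun l _ => Finset.mem_range.mpr (ZMod.val_lt l))
    (fun _ _ _ _ h => ZMod.val_injective N h)
    (fun n hn => ⟨n, Finset.mem_univ _, ZMod.val_cast_of_lt (Finset.mem_range.mp hn)⟩)
    (fun l _ => by rw [ZMod.natCast_zmod_val])

lemma measurement_eq_sum (L : ℕ) (z : ZMod N → ℂ) (k m : ℕ) :
    measurement L z k m = (1 / (N : ℝ) * ‖∑ l ∈ Finset.range N,
      coeff z l * dft z ((k : ZMod N) - l) * rootW N L ^ (l * m)‖) ^ 2 := by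
  rw [measurement, dft_mul_comp_add, norm_mul, sum_univ_eq_sum_range, norm_inv,
    Complex.norm_natCast, one_div]
  congr 3
  refine Finset.sum_congr rfl fun l _ => ?_
  rw [rootW_pow_eq_stdAddChar, coeff]
  congr 2
  push_cast
  ring

lemma dft_sub_eq_coeff (z : ZMod N → ℂ) {k l : ℕ} (h : l ≤ k) :
    dft z ((k : ZMod N) - l) = coeff z (k - l) := by
  rw [coeff, Nat.cast_sub h]

lemma dft_sub_eq_coeff_add (z : ZMod N → ℂ) {k l : ℕ} (h : l ≤ N + k) :
    dft z ((k : ZMod N) - l) = coeff z (N + k - l) := by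
  rw [coeff, Nat.cast_sub h, Nat.cast_add, ZMod.natCast_self, zero_add]

-- For `l > k` one of the frequencies `l` and `N + k - l` lies beyond `N / 2`, unless both equal it.
lemma coeff_mul_dft_sub_eq_zero (hz : IsAnalytic z) {k l : ℕ} (hkl : k < l)
    (hl : l < N) (hhalf : k = 0 → l ≠ N / 2) : coeff z l * dft z ((k : ZMod N) - l) = 0 := by
  rcases le_or_gt l (N / 2) with h | h
  · rw [dft_sub_eq_coeff_add z (by lia), coeff_eq_zero hz (k := N + k - l) (by lia) (by lia),
      mul_zero]
  · rw [coeff_eq_zero hz h hl, zero_mul]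

lemma measurement_eq (hz : IsAnalytic z) (L : ℕ) {k : ℕ} (hk : 1 ≤ k) (hkN : k ≤ N / 2) (m : ℕ) :
    measurement L z k m = (1 / (N : ℝ) * ‖∑ l ∈ Finset.range (k + 1),
      coeff z l * coeff z (k - l) * rootW N L ^ (l * m)‖) ^ 2 := by
  have hsub : Finset.range (k + 1) ⊆ Finset.range N := Finset.range_subset_range.mpr (by lia)
  rw [measurement_eq_sum, ← Finset.sum_subset hsub]
  · refine congrArg (fun x => (1 / (N : ℝ) * ‖x‖) ^ 2) (Finset.sum_congr rfl fun l hl => ?_)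
    rw [dft_sub_eq_coeff z (Nat.lt_succ_iff.mp (Finset.mem_range.mp hl))]
  · intro l hl hl'
    rw [Finset.mem_range] at hl hl'
    rw [coeff_mul_dft_sub_eq_zero hz (by lia) hl (by lia), zero_mul]

lemma rootW_pow_half {L : ℕ} (hN : Even N) (hL : Odd L) : rootW N L ^ (N / 2) = -1 := by
  obtain ⟨M, hM⟩ := hN.two_dvd
  have hM0 : (M : ℂ) ≠ 0 := by have := NeZero.ne N; exact_mod_cast (by lia : M ≠ 0)
  have h : rootW N L ^ (N / 2) = Complex.exp ((Real.pi : ℂ) * Complex.I) ^ L := by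
    rw [rootW, ← Complex.exp_nat_mul, ← Complex.exp_nat_mul, hM, Nat.mul_div_cancel_left M two_pos]
    congr 1
    push_cast
    field_simp
  rw [h, Complex.exp_pi_mul_I, hL.neg_one_pow]

lemma measurement_zero_eq (hz : IsAnalytic z) (hN : Even N) {L : ℕ} (hL : Odd L) (m : ℕ) :
    measurement L z 0 m =
      (1 / (N : ℝ) * ‖coeff z 0 ^ 2 + coeff z (N / 2) ^ 2 * (-1) ^ m‖) ^ 2 := by
  have hN0 := NeZero.ne N
  have hN2 := Nat.two_mul_div_two_of_even hN
  have hsub : ({0, N / 2} : Finset ℕ) ⊆ Finset.range N := by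
    simp only [Finset.insert_subset_iff, Finset.singleton_subset_iff, Finset.mem_range]
    lia
  rw [measurement_eq_sum, ← Finset.sum_subset hsub, Finset.sum_pair (by lia)]
  · rw [dft_sub_eq_coeff z le_rfl, dft_sub_eq_coeff_add z (by lia),
      pow_mul (rootW N L) (N / 2), rootW_pow_half hN hL, show N + 0 - N / 2 = N / 2 by lia]
    simp only [Nat.sub_zero, zero_mul, pow_zero, mul_one, pow_two]
  · intro l hl hl'
    simp only [Finset.mem_insert, Finset.mem_singleton, not_or] at hl'
    rw [Finset.mem_range] at hl
    rw [coeff_mul_dft_sub_eq_zero hz (by lia) hl fun _ => hl'.2, zero_mul]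

lemma fits_coeff (hz : IsAnalytic z) {L : ℕ} {b : ℕ → ℕ → ℝ} {k m : ℕ} (hk : 1 ≤ k)
    (hkN : k ≤ N / 2) (hb : b k m = measurement L z k m) : Fits N L b (coeff z) k m := by
  rw [Fits, hb, measurement_eq hz L hk hkN, Real.sqrt_sq (by positivity)]

end Measurement

/-! ### Distinctness of the points `w ^ i` and of their real parts -/

section RootsOfUnity

variable {N L : ℕ}

lemma pos_of_lt_numShifts {i : ℕ} (hi : i < numShifts N L) : 0 < L := by
  rcases Nat.eq_zero_or_pos L with rfl | hL
  · simp [numShifts] at hi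
  · exact hL

lemma mul_lt_of_lt_numShifts {i : ℕ} (hi : i < numShifts N L) : i * L < N := by
  have hL : (0 : ℝ) < L := Nat.cast_pos.mpr (pos_of_lt_numShifts hi)
  have h := Nat.lt_ceil.mp hi
  rw [lt_div_iff₀ hL] at h
  exact_mod_cast h

lemma eq_numShifts_of_mul_eq {n : ℕ} (hL : 0 < L) (h : n * L = N) : n = numShifts N L := by
  have hL' : (L : ℝ) ≠ 0 := by exact_mod_cast hL.ne'
  rw [numShifts, ← h, Nat.cast_mul, mul_div_cancel_right₀ _ hL', Nat.ceil_natCast]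

lemma eq_or_mul_eq_one_of_re_eq {a b : ℂ} (ha : ‖a‖ = 1) (hb : ‖b‖ = 1) (h : a.re = b.re) :
    a = b ∨ a * b = 1 := by
  have him : a.im ^ 2 = b.im ^ 2 := by
    have ha' := Complex.sq_norm_sub_sq_re a
    have hb' := Complex.sq_norm_sub_sq_re b
    rw [ha, h] at ha'
    rw [hb] at hb'
    rw [← ha', hb']
  rcases sq_eq_sq_iff_eq_or_eq_neg.mp him with him | him
  · exact .inl (Complex.ext h him)
  · have hab : a = conj b := Complex.ext h him
    exact .inr (by rw [hab, Complex.conj_mul', hb, Complex.ofReal_one, one_pow])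

variable [NeZero N]

lemma norm_rootW_pow (L n : ℕ) : ‖rootW N L ^ n‖ = 1 := by
  rw [rootW_pow_eq_stdAddChar, AddChar.norm_apply]

lemma rootW_pow_injOn {i j : ℕ} (hi : i < numShifts N L) (hj : j < numShifts N L)
    (h : rootW N L ^ i = rootW N L ^ j) : i = j := by
  rw [rootW_pow_eq_stdAddChar, rootW_pow_eq_stdAddChar, injective_stdAddChar.eq_iff,
    ZMod.natCast_eq_natCast_iff', Nat.mod_eq_of_lt (mul_lt_of_lt_numShifts hi),
    Nat.mod_eq_of_lt (mul_lt_of_lt_numShifts hj)] at h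
  exact Nat.eq_of_mul_eq_mul_right (pos_of_lt_numShifts hi) h

lemma add_eq_numShifts_of_rootW_pow {i j : ℕ} (hi : i < numShifts N L) (hj : j < numShifts N L)
    (hij : i ≠ j) (h : rootW N L ^ (i + j) = 1) : i + j = numShifts N L := by
  have hL := pos_of_lt_numShifts hi
  have hlt : (i + j) * L < 2 * N := by
    have := mul_lt_of_lt_numShifts hi
    have := mul_lt_of_lt_numShifts hj
    rw [add_mul]; lia
  have hpos : 0 < (i + j) * L := Nat.mul_pos (by lia) hL
  rw [rootW_pow_eq_stdAddChar, ← (stdAddChar (N := N)).map_zero_eq_one,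
    injective_stdAddChar.eq_iff, ZMod.natCast_eq_zero_iff] at h
  exact eq_numShifts_of_mul_eq hL (Nat.eq_of_dvd_of_lt_two_mul hpos.ne' h hlt)

lemma rootW_pow_re_ne {i j : ℕ} (hi : i < numShifts N L) (hj : j < numShifts N L) (hij : i ≠ j)
    (hsum : i + j ≠ numShifts N L) : (rootW N L ^ i).re ≠ (rootW N L ^ j).re := by
  intro h
  rcases eq_or_mul_eq_one_of_re_eq (norm_rootW_pow L i) (norm_rootW_pow L j) h with h | h
  · exact hij (rootW_pow_injOn hi hj h)
  · exact hsum (add_eq_numShifts_of_rootW_pow hi hj hij (by rw [pow_add, h]))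

end RootsOfUnity

/-! ### Ratios of cosines -/

section CosRatio

/-- For `o = exp (i θ)` this is the ratio `cos ((k/2 - l) θ) / cos (k θ / 2)`. -/
def cosRatio (k l : ℕ) (o : ℂ) : ℝ := ((o ^ l + o ^ (k - l)) / (1 + o ^ k)).re

/-- Unimodular points at which `cosRatio k l` has a nonzero denominator, and which are distinct even
up to complex conjugation. -/
structure IsSeparated {ι : Type*} (k : ℕ) (o : ι → ℂ) : Prop where
  norm_eq_one : ∀ p, ‖o p‖ = 1
  pow_ne : ∀ p, o p ^ k ≠ -1
  re_injective : Function.Injective fun p => (o p).re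

variable {k l : ℕ} {o : ℂ}

lemma ofReal_cosRatio (ho : ‖o‖ = 1) (hl : l ≤ k) :
    (cosRatio k l o : ℂ) = (o ^ l + o ^ (k - l)) / (1 + o ^ k) := by
  have h0 : o ≠ 0 := norm_ne_zero_iff.mp (ho ▸ one_ne_zero)
  rw [cosRatio, ← Complex.conj_eq_iff_re]
  simp only [map_div₀, map_add, map_pow, map_one, ← Complex.inv_eq_conj ho]
  rw [← mul_div_mul_left _ _ (pow_ne_zero k h0)]
  congr 1
  · rw [mul_add, inv_pow, inv_pow, ← pow_sub₀ o h0 hl, ← pow_sub₀ o h0 (Nat.sub_le k l),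
      Nat.sub_sub_self hl, add_comm]
  · rw [mul_add, mul_one, inv_pow, mul_inv_cancel₀ (pow_ne_zero k h0), add_comm]

lemma one_add_ne_zero_of_ne_neg_one {x : ℂ} (h : x ≠ -1) : 1 + x ≠ 0 :=
  fun e => h (eq_neg_of_add_eq_zero_right e)

lemma cosRatio_mul (ho : ‖o‖ = 1) (hk : o ^ k ≠ -1) (hl : l ≤ k) :
    (cosRatio k l o : ℂ) * (1 + o ^ k) = o ^ l + o ^ (k - l) := by
  rw [ofReal_cosRatio ho hl, div_mul_cancel₀ _ (one_add_ne_zero_of_ne_neg_one hk)]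

lemma cosRatio_zero (hk : o ^ k ≠ -1) : cosRatio k 0 o = 1 := by
  rw [cosRatio, pow_zero, Nat.sub_zero, div_self (one_add_ne_zero_of_ne_neg_one hk), Complex.one_re]

lemma cosRatio_symm (hl : l ≤ k) : cosRatio k (k - l) o = cosRatio k l o := by
  rw [cosRatio, cosRatio, Nat.sub_sub_self hl, add_comm (o ^ (k - l))]

lemma cosRatio_self (hk : o ^ k ≠ -1) : cosRatio k k o = 1 := by
  rw [← cosRatio_symm le_rfl, Nat.sub_self, cosRatio_zero hk]

lemma cosRatio_recurrence (ho : ‖o‖ = 1) (hk : o ^ k ≠ -1) (hl : l + 2 ≤ k) :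
    cosRatio k (l + 2) o + cosRatio k l o = 2 * o.re * cosRatio k (l + 1) o := by
  obtain ⟨j, rfl⟩ := Nat.exists_eq_add_of_le' hl
  have h₀ := cosRatio_mul ho hk (l := l) (by lia)
  have h₁ := cosRatio_mul ho hk (l := l + 1) (by lia)
  have h₂ := cosRatio_mul ho hk (l := l + 2) (by lia)
  rw [show j + (l + 2) - l = j + 2 by lia] at h₀
  rw [show j + (l + 2) - (l + 1) = j + 1 by lia] at h₁
  rw [Nat.add_sub_cancel] at h₂
  have hre : o + o⁻¹ = 2 * (o.re : ℂ) := by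
    rw [Complex.inv_eq_conj ho, Complex.add_conj]; push_cast; rfl
  have hinv : o * o⁻¹ = 1 := mul_inv_cancel₀ (norm_ne_zero_iff.mp (ho ▸ one_ne_zero))
  apply Complex.ofReal_injective
  push_cast
  rw [← hre]
  refine mul_right_cancel₀ (one_add_ne_zero_of_ne_neg_one hk) ?_
  linear_combination h₀ + h₂ - (o + o⁻¹) * h₁ - (o ^ l + o ^ j) * hinv

lemma cosRatio_half_ne_zero (ho : ‖o‖ = 1) (hk : o ^ k ≠ -1) : cosRatio k (k / 2) o ≠ 0 := by
  have h0 : o ≠ 0 := norm_ne_zero_iff.mp (ho ▸ one_ne_zero)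
  intro h
  have hsum := cosRatio_mul ho hk (Nat.div_le_self k 2)
  rw [h, Complex.ofReal_zero, zero_mul, eq_comm] at hsum
  obtain ⟨j, rfl | rfl⟩ := Nat.even_or_odd' k
  · rw [show 2 * j / 2 = j by lia, show 2 * j - j = j by lia, ← two_mul] at hsum
    exact mul_ne_zero two_ne_zero (pow_ne_zero _ h0) hsum
  · rw [show (2 * j + 1) / 2 = j by lia, show 2 * j + 1 - j = j + 1 by lia] at hsum
    have ho' : o = -1 := eq_neg_of_add_eq_zero_right
      ((mul_eq_zero.mp ((by ring : o ^ j * (1 + o) = _).trans hsum)).resolve_left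
        (pow_ne_zero _ h0))
    exact hk (by rw [ho', Odd.neg_one_pow ⟨j, rfl⟩])

lemma sum_two_re_pow_mul_cosRatio_eq_zero {ι : Type*} [Fintype ι] {o : ι → ℂ}
    (ho : ∀ p, ‖o p‖ = 1) (hok : ∀ p, o p ^ k ≠ -1) {ν : ι → ℝ}
    (h : ∀ l ≤ k, ∑ p, ν p * cosRatio k l (o p) = 0) (j : ℕ) :
    ∀ l, j ≤ l → l + j ≤ k → ∑ p, ν p * cosRatio k l (o p) * (2 * (o p).re) ^ j = 0 := by
  induction j with
  | zero => simpa using h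
  | succ j ih =>
    intro l hjl hlk
    obtain ⟨l, rfl⟩ := Nat.exists_eq_add_of_le' (show 1 ≤ l by lia)
    calc ∑ p, ν p * cosRatio k (l + 1) (o p) * (2 * (o p).re) ^ (j + 1)
        = ∑ p, ν p * cosRatio k (l + 2) (o p) * (2 * (o p).re) ^ j +
            ∑ p, ν p * cosRatio k l (o p) * (2 * (o p).re) ^ j := by
          rw [← Finset.sum_add_distrib]
          refine Finset.sum_congr rfl fun p _ => ?_
          linear_combination (-ν p * (2 * (o p).re) ^ j) *
            cosRatio_recurrence (ho p) (hok p) (l := l) (by lia)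
      _ = 0 := by rw [ih _ (by lia) (by lia), ih _ (by lia) (by lia), add_zero]

lemma IsSeparated.eq_zero_of_sum_cosRatio_eq_zero {n : ℕ} {o : Fin n → ℂ} (ho : IsSeparated k o)
    (hn : n ≤ k / 2 + 1) {ν : Fin n → ℝ} (h : ∀ l ≤ k, ∑ p, ν p * cosRatio k l (o p) = 0) :
    ν = 0 := by
  have hmoments : (fun p => ν p * cosRatio k (k / 2) (o p)) = 0 :=
    Matrix.eq_zero_of_forall_pow_sum_mul_pow_eq_zero (f := fun p => 2 * (o p).re)
      (fun p q hpq => ho.re_injective (mul_left_cancel₀ two_ne_zero hpq))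
      fun i => sum_two_re_pow_mul_cosRatio_eq_zero ho.norm_eq_one ho.pow_ne h i _ (by lia) (by lia)
  funext p
  exact (mul_eq_zero.mp (congrFun hmoments p)).resolve_right
    (cosRatio_half_ne_zero (ho.norm_eq_one p) (ho.pow_ne p))

lemma IsSeparated.isUnit_cosRatio {n : ℕ} {o : Fin n → ℂ} (ho : IsSeparated k o)
    (hn : n = k / 2 + 1) : IsUnit (Matrix.of fun p l : Fin n => cosRatio k l (o p)) := by
  refine Matrix.vecMul_injective_iff_isUnit.mp
    ((injective_iff_map_eq_zero (Matrix.vecMulLinear _)).mpr fun ν hν => ?_)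
  have hhalf (l : ℕ) (hl : l ≤ k / 2) : ∑ p, ν p * cosRatio k l (o p) = 0 :=
    congrFun hν ⟨l, by lia⟩
  refine ho.eq_zero_of_sum_cosRatio_eq_zero hn.le fun l hl => ?_
  obtain hl' | hl' := le_or_gt l (k / 2)
  · exact hhalf l hl'
  · simpa only [cosRatio_symm hl] using hhalf (k - l) (by lia)

end CosRatio

/-! ### The measurement equations as distance equations -/

section CrossTerm

/-- The part of `∑ l, u l * u (k - l) * o ^ l` free of `u 0` and `u k`, divided by
`(1 + o ^ k) / 2`. -/
def crossTerm (u : ℕ → ℂ) (k : ℕ) (o : ℂ) : ℂ :=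
  ∑ l ∈ Finset.Ico 1 k, u l * u (k - l) * (cosRatio k l o : ℂ)

lemma sum_mul_pow_flip (u : ℕ → ℂ) (k : ℕ) (o : ℂ) :
    ∑ l ∈ Finset.range (k + 1), u l * u (k - l) * o ^ (k - l) =
      ∑ l ∈ Finset.range (k + 1), u l * u (k - l) * o ^ l := by
  rw [← Finset.sum_flip]
  refine Finset.sum_congr rfl fun l hl => ?_
  rw [Nat.sub_sub_self (Finset.mem_range_succ_iff.mp hl), mul_comm (u (k - l))]

lemma sum_eq_sum_cosRatio (u : ℕ → ℂ) {k : ℕ} {o : ℂ} (ho : ‖o‖ = 1) (hok : o ^ k ≠ -1) :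
    ∑ l ∈ Finset.range (k + 1), u l * u (k - l) * o ^ l =
      (1 + o ^ k) / 2 * ∑ l ∈ Finset.range (k + 1), u l * u (k - l) * (cosRatio k l o : ℂ) := by
  calc ∑ l ∈ Finset.range (k + 1), u l * u (k - l) * o ^ l
      = 2⁻¹ * (∑ l ∈ Finset.range (k + 1), u l * u (k - l) * o ^ l +
          ∑ l ∈ Finset.range (k + 1), u l * u (k - l) * o ^ (k - l)) := by
        rw [sum_mul_pow_flip]; ring
    _ = _ := by
      rw [← Finset.sum_add_distrib, Finset.mul_sum, Finset.mul_sum]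
      refine Finset.sum_congr rfl fun l hl => ?_
      linear_combination (-(u l * u (k - l)) / 2) *
        cosRatio_mul ho hok (Finset.mem_range_succ_iff.mp hl)

lemma sum_eq_crossTerm (u : ℕ → ℂ) {k : ℕ} (hk : 1 ≤ k) {o : ℂ} (ho : ‖o‖ = 1)
    (hok : o ^ k ≠ -1) :
    ∑ l ∈ Finset.range (k + 1), u l * u (k - l) * o ^ l =
      (1 + o ^ k) / 2 * (2 * (u 0 * u k) + crossTerm u k o) := by
  rw [sum_eq_sum_cosRatio u ho hok, Finset.sum_range_succ, Finset.range_eq_Ico,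
    Finset.sum_eq_sum_Ico_succ_bot hk, cosRatio_self hok, cosRatio_zero hok, Nat.sub_zero,
    Nat.sub_self, crossTerm]
  push_cast
  ring

lemma norm_eq_of_fits {N L : ℕ} [NeZero N] {b : ℕ → ℕ → ℝ} {u v : ℕ → ℂ} {k m : ℕ} (hk : 1 ≤ k)
    (hw : rootW N L ^ (k * m) ≠ -1) (hu : Fits N L b u k m) (hv : Fits N L b v k m) :
    ‖2 * (u 0 * u k) + crossTerm u k (rootW N L ^ m)‖ =
      ‖2 * (v 0 * v k) + crossTerm v k (rootW N L ^ m)‖ := by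
  have h := hu.symm.trans hv
  simp only [mul_comm _ m, pow_mul] at h hw
  rw [sum_eq_crossTerm u hk (norm_rootW_pow L m) hw,
    sum_eq_crossTerm v hk (norm_rootW_pow L m) hw, norm_mul, norm_mul] at h
  exact mul_left_cancel₀ (norm_ne_zero_iff.mpr
    (div_ne_zero (one_add_ne_zero_of_ne_neg_one hw) two_ne_zero))
    (mul_left_cancel₀ (one_div_ne_zero (NeZero.ne _)) h)

lemma crossTerm_congr {u v : ℕ → ℂ} {k : ℕ} (h : ∀ j, 1 ≤ j → j < k → u j = v j) (o : ℂ) :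
    crossTerm u k o = crossTerm v k o := by
  refine Finset.sum_congr rfl fun l hl => ?_
  obtain ⟨hl₁, hlk⟩ := Finset.mem_Ico.mp hl
  rw [h l hl₁ hlk, h (k - l) (by lia) (by lia)]

lemma crossTerm_two (u : ℕ → ℂ) (o : ℂ) : crossTerm u 2 o = cosRatio 2 1 o * (u 1 * u 1) := by
  simp [crossTerm, mul_comm]

lemma crossTerm_three (u : ℕ → ℂ) (o : ℂ) :
    crossTerm u 3 o = cosRatio 3 1 o * (2 * (u 1 * u 2)) := by
  have hsymm : cosRatio 3 2 o = cosRatio 3 1 o := cosRatio_symm (l := 1) (by lia)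
  simp only [crossTerm, Finset.sum_Ico_eq_sum_range, Finset.sum_range_succ, Finset.sum_range_zero,
    Nat.reduceAdd, Nat.reduceSub, hsymm]
  ring

lemma crossTerm_four (u : ℕ → ℂ) (o : ℂ) : crossTerm u 4 o =
    cosRatio 4 1 o * (2 * (u 1 * u 3)) + cosRatio 4 2 o * (u 2 * u 2) := by
  have hsymm : cosRatio 4 3 o = cosRatio 4 1 o := cosRatio_symm (l := 1) (by lia)
  simp only [crossTerm, Finset.sum_Ico_eq_sum_range, Finset.sum_range_succ, Finset.sum_range_zero,
    Nat.reduceAdd, Nat.reduceSub, hsymm]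
  ring

end CrossTerm

/-! ### Points determined by distances -/

section Circles

lemma normSq_eq_of_norm_eq {x y : ℂ} (h : ‖x‖ = ‖y‖) : Complex.normSq x = Complex.normSq y := by
  rw [Complex.normSq_eq_norm_sq, Complex.normSq_eq_norm_sq, h]

lemma eq_of_three_distances {X Y P Q R : ℂ} (hP : ‖X + P‖ = ‖Y + P‖) (hQ : ‖X + Q‖ = ‖Y + Q‖)
    (hR : ‖X + R‖ = ‖Y + R‖) (h : ((Q - P) * conj (R - P)).im ≠ 0) : X = Y := by
  replace hP := normSq_eq_of_norm_eq hP
  replace hQ := normSq_eq_of_norm_eq hQ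
  replace hR := normSq_eq_of_norm_eq hR
  simp only [Complex.normSq_apply, Complex.add_re, Complex.add_im] at hP hQ hR
  simp only [Complex.mul_im, Complex.conj_re, Complex.conj_im, Complex.sub_re,
    Complex.sub_im] at h
  have horthQ : (X.re - Y.re) * (Q.re - P.re) + (X.im - Y.im) * (Q.im - P.im) = 0 := by
    linear_combination (hQ - hP) / 2
  have horthR : (X.re - Y.re) * (R.re - P.re) + (X.im - Y.im) * (R.im - P.im) = 0 := by
    linear_combination (hR - hP) / 2
  refine Complex.ext (sub_eq_zero.mp (mul_right_cancel₀ h ?_))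
    (sub_eq_zero.mp (mul_right_cancel₀ h ?_))
  · linear_combination (-(R.im - P.im)) * horthQ + (Q.im - P.im) * horthR
  · linear_combination (R.re - P.re) * horthQ - (Q.re - P.re) * horthR

lemma eq_or_eq_reflection {X Y P : ℂ} {s t : ℝ} (hst : s ≠ t) (hP : P ≠ 0)
    (hs : ‖X + s * P‖ = ‖Y + s * P‖) (ht : ‖X + t * P‖ = ‖Y + t * P‖) :
    X = Y ∨ X * conj P = conj Y * P := by
  replace hs := normSq_eq_of_norm_eq hs
  replace ht := normSq_eq_of_norm_eq ht
  simp only [Complex.normSq_apply, Complex.add_re, Complex.add_im, Complex.re_ofReal_mul,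
    Complex.im_ofReal_mul] at hs ht
  have hdot : X.re * P.re + X.im * P.im = Y.re * P.re + Y.im * P.im :=
    mul_left_cancel₀ (sub_ne_zero.mpr hst) (by linear_combination (hs - ht) / 2)
  have hnorm : X.re ^ 2 + X.im ^ 2 = Y.re ^ 2 + Y.im ^ 2 := by
    linear_combination hs - 2 * s * hdot
  have hcross : (X.im * P.re - X.re * P.im) ^ 2 = (Y.im * P.re - Y.re * P.im) ^ 2 := by
    linear_combination (P.re ^ 2 + P.im ^ 2) * hnorm -
      ((X.re * P.re + X.im * P.im) + (Y.re * P.re + Y.im * P.im)) * hdot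
  obtain h | h := sq_eq_sq_iff_eq_or_eq_neg.mp hcross
  · refine .inl (mul_right_cancel₀ ((map_ne_zero conj).mpr hP) (Complex.ext ?_ ?_)) <;>
      simp only [Complex.mul_re, Complex.mul_im, Complex.conj_re, Complex.conj_im] <;> linarith
  · refine .inr (Complex.ext ?_ ?_) <;>
      simp only [Complex.mul_re, Complex.mul_im, Complex.conj_re, Complex.conj_im] <;> linarith

/-- The coefficients of the product of `cosRatio 4 1` and `cosRatio 4 2` at three separated points
in terms of `1`, `cosRatio 4 1` and `cosRatio 4 2`. -/
def productCoeffs (o : Fin 3 → ℂ) : Fin 3 → ℝ :=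
  Matrix.mulVec (Matrix.of fun p l : Fin 3 => cosRatio 4 l (o p))⁻¹
    fun p => cosRatio 4 1 (o p) * cosRatio 4 2 (o p)

variable {o : Fin 3 → ℂ}

lemma IsSeparated.cosRatio_four_mulVec (ho : IsSeparated 4 o) (f : Fin 3 → ℝ) (p : Fin 3) :
    Matrix.mulVec (Matrix.of fun p l : Fin 3 => cosRatio 4 l (o p)) f p =
      f 0 + f 1 * cosRatio 4 1 (o p) + f 2 * cosRatio 4 2 (o p) := by
  simp only [Matrix.mulVec, dotProduct, Fin.sum_univ_three, Matrix.of_apply, Fin.val_zero,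
    Fin.val_one, Fin.val_two, cosRatio_zero (ho.pow_ne p)]
  ring

lemma IsSeparated.cosRatio_four_mul (ho : IsSeparated 4 o) (p : Fin 3) :
    cosRatio 4 1 (o p) * cosRatio 4 2 (o p) = productCoeffs o 0 +
      productCoeffs o 1 * cosRatio 4 1 (o p) + productCoeffs o 2 * cosRatio 4 2 (o p) := by
  have hdet := (Matrix.isUnit_iff_isUnit_det _).mp (ho.isUnit_cosRatio rfl)
  rw [← ho.cosRatio_four_mulVec, productCoeffs, Matrix.mulVec_mulVec, Matrix.mul_nonsing_inv _ hdet,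
    Matrix.one_mulVec]

lemma IsSeparated.eq_zero_of_cosRatio_four (ho : IsSeparated 4 o) {f : Fin 3 → ℝ}
    (h : ∀ p, f 0 + f 1 * cosRatio 4 1 (o p) + f 2 * cosRatio 4 2 (o p) = 0) : f = 0 := by
  refine Matrix.mulVec_injective_iff_isUnit.mpr (ho.isUnit_cosRatio rfl) ?_
  funext p
  rw [ho.cosRatio_four_mulVec, h, Matrix.mulVec_zero, Pi.zero_apply]

/-- The result of eliminating the unknown `X` from the equations
`‖X + (αₚ T + βₚ C)‖ = ‖Y + (αₚ S + βₚ C)‖`, `p = 0, 1, 2`, where `‖S‖ = ‖T‖` and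
`αₚ βₚ = f 0 + f 1 αₚ + f 2 βₚ`. -/
def excluder (f : Fin 3 → ℝ) (S T Y : ℂ) (C : ℝ) : ℝ :=
  T.im ^ 2 * (Y.re - (T.re - S.re) * f 2) ^ 2 +
    (Y.re * (S.re - T.re) + Y.im * S.im - C * (T.re - S.re) * f 1 +
      (T.re - S.re) * f 2 * T.re) ^ 2 -
    T.im ^ 2 * (Y.re ^ 2 + Y.im ^ 2) + 2 * T.im ^ 2 * C * (T.re - S.re) * f 0

lemma excluder_conj (f : Fin 3 → ℝ) (S T Y : ℂ) (C : ℝ) :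
    excluder f (conj S) (conj T) (conj Y) C = excluder f S T Y C := by
  simp only [excluder, Complex.conj_re, Complex.conj_im]
  ring

lemma IsSeparated.excluder_eq_zero (ho : IsSeparated 4 o) {S T X Y : ℂ} {C : ℝ} (hC : C ≠ 0)
    (hST : ‖S‖ = ‖T‖)
    (h : ∀ p, ‖X + (cosRatio 4 1 (o p) * T + cosRatio 4 2 (o p) * C)‖ =
      ‖Y + (cosRatio 4 1 (o p) * S + cosRatio 4 2 (o p) * C)‖) :
    excluder (productCoeffs o) S T Y C = 0 := by
  set f := productCoeffs o
  replace hST := normSq_eq_of_norm_eq hST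
  simp only [Complex.normSq_apply] at hST
  have hcoeffs : ![X.re ^ 2 + X.im ^ 2 - Y.re ^ 2 - Y.im ^ 2 + 2 * C * (T.re - S.re) * f 0,
      2 * (X.re * T.re + X.im * T.im - Y.re * S.re - Y.im * S.im) + 2 * C * (T.re - S.re) * f 1,
      2 * C * (X.re - Y.re) + 2 * C * (T.re - S.re) * f 2] = 0 := by
    refine ho.eq_zero_of_cosRatio_four fun p => ?_
    have hp := normSq_eq_of_norm_eq (h p)
    simp only [Complex.normSq_apply, Complex.add_re, Complex.add_im, Complex.re_ofReal_mul,
      Complex.im_ofReal_mul, Complex.ofReal_re, Complex.ofReal_im] at hp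
    simp only [Matrix.cons_val]
    linear_combination hp - 2 * C * (T.re - S.re) * ho.cosRatio_four_mul p +
      cosRatio 4 1 (o p) ^ 2 * hST
  have h₀ := congrFun hcoeffs 0
  have h₁ := congrFun hcoeffs 1
  have h₂ := congrFun hcoeffs 2
  simp only [Matrix.cons_val, Pi.zero_apply] at h₀ h₁ h₂
  have hre : X.re = Y.re - (T.re - S.re) * f 2 :=
    mul_left_cancel₀ (mul_ne_zero two_ne_zero hC) (by linear_combination h₂)
  rw [hre] at h₀ h₁
  have him : T.im * X.im = Y.re * (S.re - T.re) + Y.im * S.im - C * (T.re - S.re) * f 1 +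
      (T.re - S.re) * f 2 * T.re := by linear_combination h₁ / 2
  rw [excluder, ← him]
  linear_combination T.im ^ 2 * h₀

end Circles

/-! ### Invariants of a spectrum -/

section Invariants

/-- The signed area (up to a factor) of the triangle formed by the cross terms at three points. -/
def spread (v : ℕ → ℂ) (k : ℕ) (o : Fin 3 → ℂ) : ℝ :=
  ((crossTerm v k (o 1) - crossTerm v k (o 0)) *
    conj (crossTerm v k (o 2) - crossTerm v k (o 0))).im

/-- The term `2 v₁ v₃` of `crossTerm v 4`, multiplied by `|v₁|² conj(v₂)²` to make it invariant
under modulation. -/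
def innerInvariant (v : ℕ → ℂ) : ℂ := Complex.normSq (v 1) * (2 * (v 1 * v 3) * conj (v 2) ^ 2)

/-- The value of `innerInvariant` after `v₃` has been reflected in the real line through
`v₁ v₂`. -/
def reflectedInvariant (v : ℕ → ℂ) : ℂ := 2 * v 1 ^ 3 * conj (v 3) * Complex.normSq (v 2)

/-- The term `2 v₀ v₄`, normalized as in `innerInvariant`. -/
def outerInvariant (v : ℕ → ℂ) : ℂ := Complex.normSq (v 1) * (2 * (v 0 * v 4) * conj (v 2) ^ 2)

/-- The term `v₂²` of `crossTerm v 4`, normalized as in `innerInvariant`. -/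
def middleInvariant (v : ℕ → ℂ) : ℝ := Complex.normSq (v 1) * Complex.normSq (v 2) ^ 2

/-- A polynomial in the entries of `v` that vanishes if replacing `v₃` by its reflection is
compatible with the equations at frequency `4` at the points `o`. -/
def spectrumExcluder (o : Fin 3 → ℂ) (v : ℕ → ℂ) : ℝ :=
  excluder (productCoeffs o) (innerInvariant v) (reflectedInvariant v) (outerInvariant v)
    (middleInvariant v)

lemma normSq_mul_two_mul_add_crossTerm_four (v : ℕ → ℂ) (o : ℂ) :
    Complex.normSq (v 1) * conj (v 2) ^ 2 * (2 * (v 0 * v 4) + crossTerm v 4 o) =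
      outerInvariant v +
        (cosRatio 4 1 o * innerInvariant v + cosRatio 4 2 o * middleInvariant v) := by
  rw [crossTerm_four, outerInvariant, innerInvariant, middleInvariant]
  push_cast [← Complex.mul_conj (v 2)]
  ring

lemma crossTerm_conj (v : ℕ → ℂ) (k : ℕ) (o : ℂ) :
    crossTerm (fun j => conj (v j)) k o = conj (crossTerm v k o) := by
  simp only [crossTerm, map_sum, map_mul, Complex.conj_ofReal]

lemma spread_conj (v : ℕ → ℂ) (k : ℕ) (o : Fin 3 → ℂ) :
    spread (fun j => conj (v j)) k o = -spread v k o := by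
  simp only [spread, crossTerm_conj, ← map_sub, ← map_mul, Complex.conj_im]

lemma spectrumExcluder_conj (o : Fin 3 → ℂ) (v : ℕ → ℂ) :
    spectrumExcluder o (fun j => conj (v j)) = spectrumExcluder o v := by
  rw [spectrumExcluder, spectrumExcluder, ← excluder_conj]
  simp only [innerInvariant, reflectedInvariant, outerInvariant, middleInvariant,
    Complex.normSq_conj, map_mul, map_pow, Complex.conj_ofReal, Complex.conj_conj, map_ofNat]

/-- Up to index `n`, the sequence `v` arises from `a` by a sign and a modulation; on the spectrum
this is the effect of a sign and a translation of the signal, apart from the condition that `e` be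
an `N`-th root of unity. -/
structure IsModulation (n : ℕ) (s e : ℂ) (a v : ℕ → ℂ) : Prop where
  sign : s = 1 ∨ s = -1
  norm_eq_one : ‖e‖ = 1
  eq_mul : ∀ k ≤ n, v k = s * a k * e ^ k

namespace IsModulation

variable {n k : ℕ} {s e : ℂ} {a v : ℕ → ℂ}

lemma mono (h : IsModulation n s e a v) (hk : k ≤ n) : IsModulation k s e a v :=
  ⟨h.sign, h.norm_eq_one, fun l hl => h.eq_mul l (hl.trans hk)⟩

lemma norm_entry (h : IsModulation n s e a v) (hk : k ≤ n) : ‖v k‖ = ‖a k‖ := by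
  rw [h.eq_mul k hk, norm_mul, norm_mul, norm_pow, norm_sign h.sign, h.norm_eq_one, one_pow,
    one_mul, mul_one]

lemma entry_ne_zero (h : IsModulation n s e a v) (hk : k ≤ n) (ha : a k ≠ 0) : v k ≠ 0 := by
  rwa [← norm_ne_zero_iff, h.norm_entry hk, norm_ne_zero_iff]

lemma mul_entry (h : IsModulation n s e a v) (hk : k ≤ n) {l : ℕ} (hl : l ≤ k) :
    v l * v (k - l) = e ^ k * (a l * a (k - l)) := by
  rw [h.eq_mul l (hl.trans hk), h.eq_mul (k - l) ((Nat.sub_le k l).trans hk),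
    ← pow_sub_mul_pow e hl]
  linear_combination (a l * a (k - l) * e ^ (k - l) * e ^ l) * sign_mul_self h.sign

lemma crossTerm_eq (h : IsModulation n s e a v) (hk : k ≤ n) (o : ℂ) :
    crossTerm v k o = e ^ k * crossTerm a k o := by
  rw [crossTerm, crossTerm, Finset.mul_sum]
  refine Finset.sum_congr rfl fun l hl => ?_
  rw [h.mul_entry hk (Finset.mem_Ico.mp hl).2.le, mul_assoc]

lemma fits (h : IsModulation n s e a v) (hk : k ≤ n) {N L m : ℕ} {b : ℕ → ℕ → ℝ}
    (ha : Fits N L b a k m) : Fits N L b v k m := by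
  have hsum : ∑ l ∈ Finset.range (k + 1), v l * v (k - l) * rootW N L ^ (l * m) =
      e ^ k * ∑ l ∈ Finset.range (k + 1), a l * a (k - l) * rootW N L ^ (l * m) := by
    rw [Finset.mul_sum]
    refine Finset.sum_congr rfl fun l hl => ?_
    rw [h.mul_entry hk (Finset.mem_range_succ_iff.mp hl), mul_assoc]
  rw [Fits, hsum, norm_mul, norm_pow, h.norm_eq_one, one_pow, one_mul]
  exact ha

lemma spread_eq (h : IsModulation n s e a v) (hk : k ≤ n) (o : Fin 3 → ℂ) :
    spread v k o = spread a k o := by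
  have he : e ^ k * conj (e ^ k) = 1 := by
    rw [Complex.mul_conj', norm_pow, h.norm_eq_one, one_pow, Complex.ofReal_one, one_pow]
  simp only [spread, h.crossTerm_eq hk, ← mul_sub, map_mul]
  rw [mul_mul_mul_comm, he, one_mul]

lemma spectrumExcluder_eq (h : IsModulation 4 s e a v) (o : Fin 3 → ℂ) :
    spectrumExcluder o v = spectrumExcluder o a := by
  have hnormSq (k : ℕ) (hk : k ≤ 4) : Complex.normSq (v k) = Complex.normSq (a k) :=
    normSq_eq_of_norm_eq (h.norm_entry hk)
  have hs : s ^ 4 = 1 := by linear_combination (s ^ 2 + 1) * sign_mul_self h.sign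
  have he (k : ℕ) : e ^ k * conj e ^ k = 1 := by
    rw [← mul_pow, Complex.mul_conj', h.norm_eq_one, Complex.ofReal_one, one_pow, one_pow]
  simp only [spectrumExcluder, innerInvariant, reflectedInvariant, outerInvariant, middleInvariant,
    hnormSq 1 (by lia), hnormSq 2 (by lia)]
  simp only [h.eq_mul 0 (by lia), h.eq_mul 1 (by lia), h.eq_mul 2 (by lia), h.eq_mul 3 (by lia),
    h.eq_mul 4 le_rfl, map_mul, map_pow, conj_sign h.sign]
  congr 1
  · linear_combination (Complex.normSq (a 1) * (2 * (a 1 * a 3) * conj (a 2) ^ 2)) *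
      ((e ^ 4 * conj e ^ 4) * hs + he 4)
  · linear_combination (2 * a 1 ^ 3 * conj (a 3) * Complex.normSq (a 2)) *
      ((e ^ 3 * conj e ^ 3) * hs + he 3)
  · linear_combination (Complex.normSq (a 1) * (2 * (a 0 * a 4) * conj (a 2) ^ 2)) *
      ((e ^ 4 * conj e ^ 4) * hs + he 4)

end IsModulation

/-- The conditions on a spectrum, all of them satisfied generically, under which the algorithm
recovers it. -/
structure NonDegenerate (N L : ℕ) (v : ℕ → ℂ) : Prop where
  zero_ne_zero : v 0 ≠ 0
  one_ne_zero : v 1 ≠ 0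
  two_ne_zero : v 2 ≠ 0
  half_ne_zero : v (N / 2) ≠ 0
  spread_ne_zero : ∀ k ∈ Finset.Icc 4 (N / 2), ∀ m : Fin 3 → Fin (numShifts N L),
    IsSeparated k (fun p => rootW N L ^ (m p : ℕ)) → spread v k (fun p => rootW N L ^ (m p : ℕ)) ≠ 0
  excluder_ne_zero : ∀ m : Fin 3 → Fin (numShifts N L),
    IsSeparated 4 (fun p => rootW N L ^ (m p : ℕ)) →
      spectrumExcluder (fun p => rootW N L ^ (m p : ℕ)) v ≠ 0

variable {N L : ℕ} {v : ℕ → ℂ}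

lemma NonDegenerate.conj (h : NonDegenerate N L v) : NonDegenerate N L (fun j => conj (v j)) where
  zero_ne_zero := (map_ne_zero _).mpr h.zero_ne_zero
  one_ne_zero := (map_ne_zero _).mpr h.one_ne_zero
  two_ne_zero := (map_ne_zero _).mpr h.two_ne_zero
  half_ne_zero := (map_ne_zero _).mpr h.half_ne_zero
  spread_ne_zero k hk m hm := by
    rw [spread_conj]
    exact neg_ne_zero.mpr (h.spread_ne_zero k hk m hm)
  excluder_ne_zero m hm := by
    rw [spectrumExcluder_conj]
    exact h.excluder_ne_zero m hm

lemma IsModulation.nonDegenerate {s e : ℂ} {a : ℕ → ℂ} (h : IsModulation (N / 2) s e a v)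
    (hN : 8 ≤ N) (ha : NonDegenerate N L a) : NonDegenerate N L v where
  zero_ne_zero := h.entry_ne_zero (by lia) ha.zero_ne_zero
  one_ne_zero := h.entry_ne_zero (by lia) ha.one_ne_zero
  two_ne_zero := h.entry_ne_zero (by lia) ha.two_ne_zero
  half_ne_zero := h.entry_ne_zero le_rfl ha.half_ne_zero
  spread_ne_zero k hk m hm := by
    rw [h.spread_eq (Finset.mem_Icc.mp hk).2]
    exact ha.spread_ne_zero k hk m hm
  excluder_ne_zero m hm := by
    rw [(h.mono (by lia : 4 ≤ N / 2)).spectrumExcluder_eq]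
    exact ha.excluder_ne_zero m hm

variable [NeZero N] {I : Shifts}

lemma Shifts.Admissible.isSeparated (hI : I.Admissible N L) {k : ℕ} (hk : 4 ≤ k)
    (hkN : k ≤ N / 2) : IsSeparated k (fun p => rootW N L ^ I.ik k p) where
  norm_eq_one p := norm_rootW_pow L _
  pow_ne p := by
    rw [← pow_mul, mul_comm]
    exact hI.ik_ne k hk hkN p
  re_injective := by
    have hlt := hI.ik_lt k hk hkN
    have hfirst := hI.ik_first k hk hkN
    have hsum (p q : Fin 3) (hpq : p < q) : I.ik k p + I.ik k q ≠ numShifts N L := by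
      obtain rfl | ⟨rfl, rfl⟩ : p = 0 ∨ p = 1 ∧ q = 2 := by lia
      · rw [hfirst, zero_add]
        exact (hlt q).ne
      · exact hI.ik_sum k hk hkN
    exact .of_lt_imp_ne fun p q hpq =>
      rootW_pow_re_ne (hlt p) (hlt q) ((hI.ik_injective k hk hkN).ne hpq.ne) (hsum p q hpq)

end Invariants

/-! ### Recovery of a nondegenerate spectrum -/

section Recovery

variable {N L : ℕ} {I : Shifts} {b : ℕ → ℕ → ℝ}

lemma rootW_pow_mul_zero_ne (k : ℕ) : rootW N L ^ (k * 0) ≠ -1 := by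
  rw [mul_zero, pow_zero]
  norm_num

lemma Fits.congr {u v : ℕ → ℂ} {k m : ℕ} (h : ∀ j ≤ k, u j = v j) (hu : Fits N L b u k m) :
    Fits N L b v k m := by
  refine hu.trans (congrArg (fun x => 1 / (N : ℝ) * ‖x‖) (Finset.sum_congr rfl fun l hl => ?_))
  rw [h l (Finset.mem_range_succ_iff.mp hl), h (k - l) (Nat.sub_le k l)]

lemma Fits.conj [NeZero N] {v : ℕ → ℂ} {k m : ℕ} (h : Fits N L b v k m) :
    Fits N L b (fun j => conj (v j)) k m := by
  have ho : rootW N L ^ m * conj (rootW N L ^ m) = 1 := by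
    rw [Complex.mul_conj', norm_rootW_pow, Complex.ofReal_one, one_pow]
  have hsum : ∑ l ∈ Finset.range (k + 1), conj (v l) * conj (v (k - l)) * (rootW N L ^ m) ^ l =
      (rootW N L ^ m) ^ k *
        conj (∑ l ∈ Finset.range (k + 1), v l * v (k - l) * (rootW N L ^ m) ^ l) := by
    rw [← sum_mul_pow_flip, map_sum, Finset.mul_sum]
    refine Finset.sum_congr rfl fun l hl => ?_
    have hpow : (rootW N L ^ m) ^ k * conj (rootW N L ^ m) ^ l = (rootW N L ^ m) ^ (k - l) := by
      rw [← pow_sub_mul_pow _ (Finset.mem_range_succ_iff.mp hl), mul_assoc, ← mul_pow, ho, one_pow,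
        mul_one]
    rw [← hpow, map_mul, map_mul, map_pow _ _ l]
    ring
  simp only [Fits, mul_comm _ m, pow_mul] at h ⊢
  rw [hsum, norm_mul, norm_pow, norm_rootW_pow, one_pow, one_mul, RCLike.norm_conj]
  exact h

lemma IsState.conj [NeZero N] {n : ℕ} {v : ℕ → ℂ} (hv : IsState N L I b n v) :
    IsState N L I b n (fun j => conj (v j)) where
  entry_zero := by rw [hv.entry_zero, Complex.conj_ofReal]
  entry_one := by rw [hv.entry_one, Complex.conj_ofReal]
  step_one := hv.step_one.imp Fits.conj Fits.conj
  step_two h4 := (hv.step_two h4).imp Fits.conj (And.imp Fits.conj fun h p => (h p).conj)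
  step_three j hj hjn p := (hv.step_three j hj hjn p).conj
  tail j hj := by rw [hv.tail j hj, map_zero]

namespace IsState

variable {n n' k : ℕ} {u v : ℕ → ℂ}

lemma truncate (hn : 2 ≤ n) (hnn : n ≤ n') (hv : IsState N L I b n' v) :
    IsState N L I b n (fun j => if j ≤ n then v j else 0) := by
  have hfits (k : ℕ) (hk : k ≤ n) (m : ℕ) (h : Fits N L b v k m) :
      Fits N L b (fun j => if j ≤ n then v j else 0) k m :=
    h.congr fun j hj => (if_pos (hj.trans hk)).symm
  exact {
    entry_zero := hv.entry_zero
    entry_one := (if_pos (by lia)).trans hv.entry_one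
    step_one := hv.step_one.imp (hfits 2 hn _) (hfits 2 hn _)
    step_two := fun h4 => (hv.step_two (h4.trans hnn)).imp (hfits 3 (by lia) _)
      (And.imp (hfits 3 (by lia) _) fun h p => hfits 4 h4 _ (h p))
    step_three := fun j hj hjn p => hfits j hjn _ (hv.step_three j hj (hjn.trans hnn) p)
    tail := fun j hj => if_neg (by lia) }

lemma zero_eq (hu : IsState N L I b n u) (hv : IsState N L I b n' v) : u 0 = v 0 :=
  hu.entry_zero.trans hv.entry_zero.symm

lemma one_eq (hu : IsState N L I b n u) (hv : IsState N L I b n' v) : u 1 = v 1 :=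
  hu.entry_one.trans hv.entry_one.symm

lemma eq_of_agree (hu : IsState N L I b n u) (hv : IsState N L I b n v)
    (h : ∀ j ≤ n, u j = v j) : u = v := by
  funext j
  obtain hj | hj := le_or_gt j n
  · exact h j hj
  · rw [hu.tail j hj, hv.tail j hj]

lemma fits (hv : IsState N L I b n v) (hk : 4 ≤ k) (hkn : k ≤ n) (p : Fin 3) :
    Fits N L b v k (I.ik k p) := by
  obtain rfl | hk := hk.eq_or_lt
  · exact (hv.step_two hkn).2.2 p
  · exact hv.step_three k hk hkn p

end IsState

variable [NeZero N]

lemma cosRatio_rootW_zero_ne {k l m : ℕ} (hl : l ≤ k) (hk : rootW N L ^ (k * m) ≠ -1)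
    (h : (rootW N L ^ m) ^ l + (rootW N L ^ m) ^ (k - l) ≠ 1 + (rootW N L ^ m) ^ k) :
    cosRatio k l (rootW N L ^ 0) ≠ cosRatio k l (rootW N L ^ m) := by
  have hone : cosRatio k l (rootW N L ^ 0) = 1 := by norm_num [cosRatio]
  intro he
  rw [mul_comm, pow_mul] at hk
  have hratio := cosRatio_mul (norm_rootW_pow L m) hk hl
  rw [← he, hone, Complex.ofReal_one, one_mul] at hratio
  exact h hratio.symm

lemma Shifts.Admissible.cosRatio_two_ne (hI : I.Admissible N L) :
    cosRatio 2 1 (rootW N L ^ 0) ≠ cosRatio 2 1 (rootW N L ^ I.i2 1) := by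
  refine cosRatio_rootW_zero_ne one_le_two (hI.i2_ne 1) fun h => hI.i2_second ?_
  rw [div_eq_div_iff (one_add_ne_zero_of_ne_neg_one (hI.i2_ne 1)) two_ne_zero, mul_comm 2 (I.i2 1),
    pow_mul]
  linear_combination h

lemma Shifts.Admissible.cosRatio_three_ne (hI : I.Admissible N L) :
    cosRatio 3 1 (rootW N L ^ 0) ≠ cosRatio 3 1 (rootW N L ^ I.i3) := by
  refine cosRatio_rootW_zero_ne (by lia) hI.i3_ne fun h => hI.i3_ratio ?_
  rw [div_eq_one_iff_eq (one_add_ne_zero_of_ne_neg_one hI.i3_ne), mul_comm 3, mul_comm 2, pow_mul,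
    pow_mul]
  linear_combination h

namespace IsState

variable {n n' k : ℕ} {u v : ℕ → ℂ}

lemma entry_two_eq_or_eq_conj (hI : I.Admissible N L) (hu : IsState N L I b n u)
    (hv : IsState N L I b n' v) (hv0 : v 0 ≠ 0) (hv1 : v 1 ≠ 0) :
    u 2 = v 2 ∨ u 2 = conj (v 2) := by
  have h₁ := norm_eq_of_fits one_le_two (rootW_pow_mul_zero_ne 2) hu.step_one.1 hv.step_one.1
  have h₂ := norm_eq_of_fits one_le_two (hI.i2_ne 1) hu.step_one.2 hv.step_one.2
  simp only [crossTerm_two, hu.zero_eq hv, hu.one_eq hv] at h₁ h₂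
  have h20 : 2 * v 0 ≠ 0 := mul_ne_zero two_ne_zero hv0
  have h11 : v 1 * v 1 ≠ 0 := mul_ne_zero hv1 hv1
  refine (eq_or_eq_reflection hI.cosRatio_two_ne h11 h₁ h₂).imp (fun h => ?_) fun h => ?_
  · exact mul_left_cancel₀ h20 (by linear_combination h)
  · simp only [map_mul, map_ofNat, hv.conj.zero_eq hv, hv.conj.one_eq hv] at h
    exact mul_left_cancel₀ h20 (mul_right_cancel₀ h11 (by linear_combination h))

lemma eq_of_spread_ne_zero (hI : I.Admissible N L) (hk : 4 ≤ k) (hkN : k ≤ N / 2)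
    (hu : IsState N L I b n u) (hkn : k ≤ n) (hv : IsState N L I b n' v) (hkn' : k ≤ n')
    (hv0 : v 0 ≠ 0) (h : ∀ j < k, u j = v j)
    (hs : spread v k (fun p => rootW N L ^ I.ik k p) ≠ 0) : u k = v k := by
  have hnorm (p : Fin 3) := norm_eq_of_fits (by lia) (hI.ik_ne k hk hkN p) (hu.fits hk hkn p)
    (hv.fits hk hkn' p)
  simp only [h 0 (by lia), crossTerm_congr fun j _ hj => h j hj] at hnorm
  have h2 : 2 * (v 0 * u k) = 2 * (v 0 * v k) :=
    eq_of_three_distances (hnorm 0) (hnorm 1) (hnorm 2) hs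
  exact mul_left_cancel₀ hv0 (mul_left_cancel₀ two_ne_zero h2)

lemma spectrumExcluder_eq_zero (hI : I.Admissible N L) (hN : 8 ≤ N) (hu : IsState N L I b n u)
    (hn : 4 ≤ n) (hv : IsState N L I b n' v) (hn' : 4 ≤ n') (hv1 : v 1 ≠ 0) (hv2 : v 2 ≠ 0)
    (h2 : u 2 = v 2) (h3 : u 3 * conj (v 2) = conj (v 3) * v 2) :
    spectrumExcluder (fun p => rootW N L ^ I.ik 4 p) v = 0 := by
  have h1 := hu.one_eq hv
  have hreal : v 1 ^ 2 = Complex.normSq (v 1) := by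
    rw [← Complex.mul_conj, hv.conj.one_eq hv, sq]
  have hinner : innerInvariant u = reflectedInvariant v := by
    rw [innerInvariant, reflectedInvariant, h1, h2, ← hreal, ← Complex.mul_conj (v 2)]
    linear_combination 2 * v 1 ^ 3 * conj (v 2) * h3
  have hmiddle : middleInvariant u = middleInvariant v := by
    rw [middleInvariant, middleInvariant, h1, h2]
  refine (hI.isSeparated le_rfl (by lia)).excluder_eq_zero (X := outerInvariant u)
    (mul_ne_zero (Complex.normSq_eq_zero.not.mpr hv1)
      (pow_ne_zero 2 (Complex.normSq_eq_zero.not.mpr hv2))) ?_ fun p => ?_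
  · simp only [innerInvariant, reflectedInvariant, norm_mul, norm_pow, Complex.norm_real,
      RCLike.norm_conj, Complex.normSq_eq_norm_sq, norm_norm]
    ring
  · have hnorm := norm_eq_of_fits (by lia) (hI.ik_ne 4 le_rfl (by lia) p) (hu.fits le_rfl hn p)
      (hv.fits le_rfl hn' p)
    have hscaled := congrArg (‖Complex.normSq (v 1) * conj (v 2) ^ 2‖ * ·) hnorm
    rwa [← norm_mul, ← norm_mul, normSq_mul_two_mul_add_crossTerm_four, ← h1, ← h2,
      normSq_mul_two_mul_add_crossTerm_four, hinner, hmiddle] at hscaled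

lemma entry_three_eq (hI : I.Admissible N L) (hN : 8 ≤ N) (hu : IsState N L I b n u) (hn : 4 ≤ n)
    (hv : IsState N L I b n' v) (hn' : 4 ≤ n') (h2 : u 2 = v 2) (hnd : NonDegenerate N L v) :
    u 3 = v 3 := by
  have h20 : 2 * v 0 ≠ 0 := mul_ne_zero two_ne_zero hnd.zero_ne_zero
  have h12 : 2 * (v 1 * v 2) ≠ 0 :=
    mul_ne_zero two_ne_zero (mul_ne_zero hnd.one_ne_zero hnd.two_ne_zero)
  obtain ⟨hu₁, hu₂, -⟩ := hu.step_two hn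
  obtain ⟨hv₁, hv₂, -⟩ := hv.step_two hn'
  have h₁ := norm_eq_of_fits (by lia) (rootW_pow_mul_zero_ne 3) hu₁ hv₁
  have h₂ := norm_eq_of_fits (by lia) hI.i3_ne hu₂ hv₂
  simp only [crossTerm_three, hu.zero_eq hv, hu.one_eq hv, h2] at h₁ h₂
  obtain h | h := eq_or_eq_reflection hI.cosRatio_three_ne h12 h₁ h₂
  · exact mul_left_cancel₀ h20 (by linear_combination h)
  · simp only [map_mul, map_ofNat, hv.conj.zero_eq hv, hv.conj.one_eq hv] at h
    have hrefl : u 3 * conj (v 2) = conj (v 3) * v 2 :=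
      mul_left_cancel₀ (mul_ne_zero h20 (mul_ne_zero two_ne_zero hnd.one_ne_zero))
        (by linear_combination h)
    exact absurd (spectrumExcluder_eq_zero hI hN hu hn hv hn' hnd.one_ne_zero hnd.two_ne_zero h2
      hrefl) (hnd.excluder_ne_zero (fun p => ⟨I.ik 4 p, hI.ik_lt 4 le_rfl (by lia) p⟩)
        (hI.isSeparated le_rfl (by lia)))

lemma eq_of_entry_two_eq (hI : I.Admissible N L) (hN : 8 ≤ N) (hu : IsState N L I b n u)
    (hn3 : n ≠ 3) (hnN : n ≤ N / 2) (hv : IsState N L I b (N / 2) v) (hnd : NonDegenerate N L v)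
    (h2 : u 2 = v 2) : ∀ j ≤ n, u j = v j := by
  intro j
  induction j using Nat.strong_induction_on with
  | _ j ih =>
    intro hj
    obtain h4 | h4 := lt_or_ge j 4
    · interval_cases j
      · exact hu.zero_eq hv
      · exact hu.one_eq hv
      · exact h2
      · exact entry_three_eq hI hN hu (by lia) hv (by lia) h2 hnd
    · have hjN := hj.trans hnN
      exact eq_of_spread_ne_zero hI h4 hjN hu hj hv hjN hnd.zero_ne_zero
        (fun i hi => ih i hi (by lia))
        (hnd.spread_ne_zero j (Finset.mem_Icc.mpr ⟨h4, hjN⟩)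
          (fun p => ⟨I.ik j p, hI.ik_lt j h4 hjN p⟩) (hI.isSeparated h4 hjN))

lemma agree_or_agree_conj (hI : I.Admissible N L) (hN : 8 ≤ N) (hu : IsState N L I b n u)
    (hn3 : n ≠ 3) (hnN : n ≤ N / 2) (hv : IsState N L I b (N / 2) v) (hnd : NonDegenerate N L v) :
    (∀ j ≤ n, u j = v j) ∨ ∀ j ≤ n, u j = (starRingEnd ℂ) (v j) :=
  (entry_two_eq_or_eq_conj hI hu hv hnd.zero_ne_zero hnd.one_ne_zero).imp
    (eq_of_entry_two_eq hI hN hu hn3 hnN hv hnd)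
    (eq_of_entry_two_eq hI hN hu hn3 hnN hv.conj hnd.conj)

lemma existsUnique_extension (hI : I.Admissible N L) (hN : 8 ≤ N) (hu : IsState N L I b n u)
    (hn : 2 ≤ n) (hn3 : n ≠ 3) (hnN : n ≤ N / 2) (hv : IsState N L I b (N / 2) v)
    (hnd : NonDegenerate N L v) :
    ∃! v' : ℕ → ℂ, IsState N L I b (N / 2) v' ∧ ∀ j ≤ n, v' j = u j := by
  wlog h : ∀ j ≤ n, u j = v j generalizing v
  · exact this hv.conj hnd.conj ((agree_or_agree_conj hI hN hu hn3 hnN hv hnd).resolve_left h)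
  refine ⟨v, ⟨hv, fun j hj => (h j hj).symm⟩, fun v' ⟨hv', hvu⟩ => ?_⟩
  exact eq_of_agree hv' hv (eq_of_entry_two_eq hI hN hv' (by lia) le_rfl hv hnd
    ((hvu 2 hn).trans (h 2 hn)))

end IsState

end Recovery

/-! ### Normal forms -/

section NormalForm

variable {N : ℕ} [NeZero N] {z : ZMod N → ℂ} {s e : ℂ} {v : ℕ → ℂ}

/-- `v` is the spectrum of the analytic signal `z` up to a sign and a modulation, extended by
zero. -/
structure IsNormalForm (z : ZMod N → ℂ) (s e : ℂ) (v : ℕ → ℂ) : Prop extends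
    IsModulation (N / 2) s e (coeff z) v where
  tail : ∀ k, N / 2 < k → v k = 0

lemma exists_sign_mul_eq_norm {c : ℂ} (hc : conj c = c) :
    ∃ s : ℂ, (s = 1 ∨ s = -1) ∧ s * c = ‖c‖ := by
  obtain ⟨x, rfl⟩ := Complex.conj_eq_iff_real.mp hc
  rw [Complex.norm_real, Real.norm_eq_abs]
  obtain h | h := le_total 0 x
  · exact ⟨1, .inl rfl, by rw [abs_of_nonneg h, one_mul]⟩
  · exact ⟨-1, .inr rfl, by rw [abs_of_nonpos h, Complex.ofReal_neg, neg_one_mul]⟩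

lemma exists_isNormalForm (hz : IsAnalytic z) (hN : 2 ≤ N) (h1 : coeff z 1 ≠ 0) :
    ∃ s e v, IsNormalForm z s e v ∧ v 0 = ‖coeff z 0‖ ∧ v 1 = ‖coeff z 1‖ := by
  obtain ⟨s, hs, hs0⟩ := exists_sign_mul_eq_norm (conj_coeff_zero hz)
  have hnorm : (‖coeff z 1‖ : ℂ) ≠ 0 := Complex.ofReal_ne_zero.mpr (norm_ne_zero_iff.mpr h1)
  set e : ℂ := s * conj (coeff z 1) / ‖coeff z 1‖ with he
  refine ⟨s, e, fun k => if k ≤ N / 2 then s * coeff z k * e ^ k else 0,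
    ⟨⟨hs, ?_, fun k hk => if_pos hk⟩, fun k hk => if_neg (by lia)⟩, ?_, ?_⟩
  · rw [he, norm_div, norm_mul, norm_sign hs, RCLike.norm_conj, Complex.norm_real, norm_norm,
      one_mul, div_self (norm_ne_zero_iff.mpr h1)]
  · rw [← hs0, ← mul_one (s * _), ← pow_zero e]
    exact if_pos (Nat.zero_le _)
  · refine (if_pos (by lia)).trans ?_
    rw [pow_one, he, mul_div_assoc', div_eq_iff hnorm, mul_mul_mul_comm, sign_mul_self hs, one_mul,
      Complex.mul_conj', sq]

lemma IsNormalForm.conj (h : IsNormalForm z s e v) :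
    IsNormalForm (reflect z) s (conj e) (fun j => conj (v j)) where
  sign := h.sign
  norm_eq_one := by rw [RCLike.norm_conj, h.norm_eq_one]
  eq_mul k hk := by
    rw [h.eq_mul k hk, map_mul, map_mul, map_pow, conj_sign h.sign, coeff, coeff, dft_reflect]
  tail k hk := by rw [h.tail k hk, map_zero]

lemma exists_stdAddChar_mul_eq_pow {η : ℂ} (hη : η ^ N = 1) :
    ∃ l : ℤ, ∀ k : ZMod N, (stdAddChar ((l : ZMod N) * k) : ℂ) = η ^ k.val := by
  obtain ⟨l, -, rfl⟩ := (Complex.isPrimitiveRoot_exp N (NeZero.ne N)).eq_pow_of_pow_eq_one hη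
  refine ⟨l, fun k => ?_⟩
  have hcast : (((l : ℤ) : ZMod N) * k) = (((l * k.val : ℕ) : ℤ) : ZMod N) := by
    push_cast
    rw [ZMod.natCast_zmod_val]
  rw [hcast, stdAddChar_coe, ← pow_mul, ← Complex.exp_nat_mul]
  congr 1
  push_cast
  ring

lemma IsNormalForm.phase_pow_eq_one (h : IsNormalForm z s e v) (hz : IsAnalytic z) (hN : Even N)
    (hne : v (N / 2) ≠ 0) :
    (e * Complex.exp (-(Complex.I * (2 / N) * (v (N / 2)).arg))) ^ N = 1 := by
  obtain ⟨M, hM⟩ := hN.exists_two_nsmul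
  obtain rfl : M = N / 2 := by lia
  have hN0 : (N : ℂ) ≠ 0 := NeZero.ne _
  have hNM : (N : ℂ) = 2 * (N / 2 : ℕ) := by exact_mod_cast hM
  set θ : ℝ := (v (N / 2)).arg
  set ε : ℂ := Complex.exp (-(Complex.I * (2 / N) * θ))
  have hε : ε ^ (N / 2) * Complex.exp (θ * Complex.I) = 1 := by
    rw [← Complex.exp_nat_mul, ← Complex.exp_add, Complex.exp_eq_one_iff]
    refine ⟨0, ?_⟩
    field_simp
    linear_combination (θ : ℂ) * hNM
  have hphase : (e * ε) ^ (N / 2) * (s * coeff z (N / 2)) = ‖v (N / 2)‖ := by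
    have hpolar := Complex.norm_mul_exp_arg_mul_I (v (N / 2))
    rw [mul_pow]
    linear_combination
      ‖v (N / 2)‖ * hε - ε ^ (N / 2) * hpolar - ε ^ (N / 2) * h.eq_mul (N / 2) le_rfl
  have hsq : (s * coeff z (N / 2)) ^ 2 = (‖v (N / 2)‖ : ℂ) ^ 2 := by
    rw [h.norm_entry le_rfl, ← Complex.mul_conj', conj_coeff_half hz hN, sq, mul_mul_mul_comm,
      sign_mul_self h.sign, one_mul]
  have hnorm : (‖v (N / 2)‖ : ℂ) ^ 2 ≠ 0 :=
    pow_ne_zero 2 (Complex.ofReal_ne_zero.mpr (norm_ne_zero_iff.mpr hne))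
  have hpow : (e * ε) ^ N = ((e * ε) ^ (N / 2)) ^ 2 := by
    rw [← pow_mul, Nat.div_two_mul_two_of_even hN]
  refine mul_right_cancel₀ hnorm ?_
  rw [hpow, ← hsq, ← mul_pow, hphase, one_mul, hsq]

lemma IsNormalForm.finalSignal_sameUpToAmbiguity (h : IsNormalForm z s e v) (hz : IsAnalytic z)
    (hN : Even N) (hne : v (N / 2) ≠ 0) : SameUpToAmbiguity (finalSignal N v) z := by
  obtain ⟨l, hl⟩ := exists_stdAddChar_mul_eq_pow (h.phase_pow_eq_one hz hN hne)
  refine ⟨s, l, h.sign, .inl ?_⟩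
  rw [finalSignal, LinearEquiv.symm_apply_eq]
  funext k
  have hk : dft z k = coeff z k.val := by rw [coeff, ZMod.natCast_zmod_val]
  rw [_root_.map_smul, Pi.smul_apply, smul_eq_mul, dft_translate, hk, hl]
  obtain hkN | hkN := le_or_gt k.val (N / 2)
  · rw [h.eq_mul _ hkN, mul_pow, ← Complex.exp_nat_mul]
    ring_nf
  · rw [h.tail _ hkN, coeff_eq_zero hz hkN (ZMod.val_lt k)]
    ring

end NormalForm

/-! ### The first entry -/

section FirstEntry

variable {N L : ℕ} {I : Shifts} {b : ℕ → ℕ → ℝ}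

lemma fits_two_iff (u : ℕ → ℂ) (m : ℕ) : Fits N L b u 2 m ↔
    1 / (N : ℝ) * ‖u 0 * u 2 * (1 + rootW N L ^ (2 * m)) + u 1 ^ 2 * rootW N L ^ m‖ =
      √(b 2 m) := by
  have h : ∑ l ∈ Finset.range (2 + 1), u l * u (2 - l) * rootW N L ^ (l * m) =
      u 0 * u 2 * (1 + rootW N L ^ (2 * m)) + u 1 ^ 2 * rootW N L ^ m := by
    simp only [Finset.sum_range_succ, Finset.sum_range_zero]
    norm_num
    ring
  rw [Fits, h, eq_comm]

lemma cosRatio_two_one_mul_re {o : ℂ} (ho : ‖o‖ = 1) (hk : o ^ 2 ≠ -1) :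
    cosRatio 2 1 o * o.re = 1 := by
  have hrec := cosRatio_recurrence ho hk (l := 0) le_rfl
  rw [zero_add, cosRatio_zero hk, zero_add, cosRatio_self hk] at hrec
  linarith

lemma zero_mem_positions {m : ℕ} (hm : m ≤ 1) : (0, m) ∈ I.positions N := by
  obtain rfl | rfl : m = 0 ∨ m = 1 := by lia
  all_goals simp [Shifts.positions]

lemma one_mem_positions : (1, 0) ∈ I.positions N := by
  simp [Shifts.positions]

lemma two_mem_positions (q : Fin 5) : (2, I.i2 q) ∈ I.positions N := by
  simp [Shifts.positions]

lemma three_mem_positions {m : ℕ} (hm : m = 0 ∨ m = I.i3) : (3, m) ∈ I.positions N := by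
  obtain rfl | rfl := hm
  all_goals simp [Shifts.positions]

lemma mem_positions_of_four_le {k : ℕ} (hk : 4 ≤ k) (hkN : k ≤ N / 2) (p : Fin 3) :
    (k, I.ik k p) ∈ I.positions N :=
  Finset.mem_union_right _ <| Finset.mem_biUnion.mpr
    ⟨k, Finset.mem_Icc.mpr ⟨hk, hkN⟩, Finset.mem_image_of_mem _ (Finset.mem_univ p)⟩

lemma norm_eq_of_norm_add_mul_eq {X Y P Q : ℂ} {x : Fin 3 → ℝ} (hx : Function.Injective x)
    (h : ∀ p, ‖X + x p * P‖ = ‖Y + x p * Q‖) : ‖P‖ = ‖Q‖ := by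
  have hzero := Matrix.eq_zero_of_forall_index_sum_mul_pow_eq_zero hx
    (v := ![Complex.normSq X - Complex.normSq Y,
      2 * (X.re * P.re + X.im * P.im) - 2 * (Y.re * Q.re + Y.im * Q.im),
      Complex.normSq P - Complex.normSq Q]) fun p => by
    have hp := normSq_eq_of_norm_eq (h p)
    simp only [Complex.normSq_apply, Complex.add_re, Complex.add_im, Complex.re_ofReal_mul,
      Complex.im_ofReal_mul] at hp
    simp only [Fin.sum_univ_three, Matrix.cons_val, Fin.val_zero, Fin.val_one, Fin.val_two,
      Complex.normSq_apply]
    linear_combination hp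
  have hsq := sub_eq_zero.mp (congrFun hzero 2)
  rw [Complex.normSq_eq_norm_sq, Complex.normSq_eq_norm_sq] at hsq
  exact (pow_left_inj₀ (norm_nonneg _) (norm_nonneg _) two_ne_zero).mp hsq

variable [NeZero N] {z : ZMod N → ℂ}

lemma Shifts.Admissible.cosRatio_two_one_ne (hI : I.Admissible N L) {q q' : Fin 5} (hq : q ≠ q')
    (hsum : I.i2 q + I.i2 q' ≠ numShifts N L) :
    cosRatio 2 1 (rootW N L ^ I.i2 q) ≠ cosRatio 2 1 (rootW N L ^ I.i2 q') := by
  intro heq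
  have hmul : ∀ q, cosRatio 2 1 (rootW N L ^ I.i2 q) * (rootW N L ^ I.i2 q).re = 1 := fun q =>
    cosRatio_two_one_mul_re (norm_rootW_pow L _) (by rw [← pow_mul, mul_comm]; exact hI.i2_ne q)
  refine rootW_pow_re_ne (hI.i2_lt q) (hI.i2_lt q') (hI.i2_injective.ne hq) hsum
    (mul_left_cancel₀ (left_ne_zero_of_mul_eq_one (hmul q)) ?_)
  rw [hmul q, heq, hmul q']

lemma Shifts.Admissible.exists_injective_cosRatio (hI : I.Admissible N L) :
    ∃ σ : Fin 3 → Fin 5,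
      Function.Injective fun p => cosRatio 2 1 (rootW N L ^ I.i2 (σ p)) := by
  obtain ⟨q, hq0, hq1, hq⟩ : ∃ q : Fin 5, 0 ≠ q ∧ 1 ≠ q ∧ I.i2 1 + I.i2 q ≠ numShifts N L := by
    by_cases h : I.i2 1 + I.i2 2 = numShifts N L
    · have hne := hI.i2_injective.ne (show (2 : Fin 5) ≠ 3 by decide)
      exact ⟨3, by decide, by decide, by lia⟩
    · exact ⟨2, by decide, by decide, h⟩
  have hzero : ∀ q, I.i2 0 + I.i2 q ≠ numShifts N L := fun q => by
    rw [hI.i2_first, zero_add]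
    exact (hI.i2_lt q).ne
  have h01 := hI.cosRatio_two_one_ne (show (0 : Fin 5) ≠ 1 by decide) (hzero 1)
  have h0q := hI.cosRatio_two_one_ne hq0 (hzero q)
  have h1q := hI.cosRatio_two_one_ne hq1 hq
  refine ⟨![0, 1, q], Function.Injective.of_lt_imp_ne ?_⟩
  simp [Fin.forall_fin_succ, h01, h0q, h1q]

lemma eq_norm_coeff_one (hI : I.Admissible N L) {t₀ t₁ : ℝ} {c : ℂ}
    (ht₁ : 0 ≤ t₁) (hz : ∀ q, Fits N L b (coeff z) 2 (I.i2 q))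
    (hc : ∀ q : Fin 5, 1 / (N : ℝ) * ‖(t₀ : ℂ) * c * (1 + rootW N L ^ (2 * I.i2 q))
      + (t₁ : ℂ) ^ 2 * rootW N L ^ (I.i2 q)‖ = √(b 2 (I.i2 q))) : t₁ = ‖coeff z 1‖ := by
  obtain ⟨σ, hσ⟩ := hI.exists_injective_cosRatio
  let u : ℕ → ℂ := fun j => if j = 0 then t₀ else if j = 1 then t₁ else c
  have hu : ∀ q, Fits N L b u 2 (I.i2 q) := fun q => (fits_two_iff u _).mpr (hc q)
  have hsq : ‖u 1 * u 1‖ = ‖coeff z 1 * coeff z 1‖ := norm_eq_of_norm_add_mul_eq hσ fun p => by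
    simpa only [crossTerm_two] using
      norm_eq_of_fits one_le_two (hI.i2_ne (σ p)) (hu (σ p)) (hz (σ p))
  rw [norm_mul, norm_mul, show u 1 = t₁ from rfl, Complex.norm_real,
    Real.norm_of_nonneg ht₁] at hsq
  exact (mul_self_inj ht₁ (norm_nonneg _)).mp hsq

lemma sqrt_measurement_zero (hz : IsAnalytic z) (hN : Even N) (hL : Odd L) (m : ℕ) :
    N * √(measurement L z 0 m) =
      |‖coeff z 0‖ ^ 2 + (-1) ^ m * ‖coeff z (N / 2)‖ ^ 2| := by
  have hsq : ∀ c : ℂ, conj c = c → c ^ 2 = (‖c‖ ^ 2 : ℝ) := fun c hc => by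
    rw [Complex.ofReal_pow, ← Complex.mul_conj', hc, sq]
  have hN0 : (N : ℝ) ≠ 0 := NeZero.ne _
  rw [measurement_zero_eq hz hN hL, Real.sqrt_sq (by positivity), ← mul_assoc,
    mul_one_div_cancel hN0, one_mul, hsq _ (conj_coeff_zero hz),
    hsq _ (conj_coeff_half hz hN), ← Real.norm_eq_abs,
    ← Complex.norm_real]
  push_cast
  rw [mul_comm]

lemma sqrt_measurement_one (hz : IsAnalytic z) (hN : 2 ≤ N)
    (hb : b 1 0 = measurement L z 1 0) :
    N * √(b 1 0) = 2 * ‖coeff z 0‖ * ‖coeff z 1‖ := by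
  have hN0 : (N : ℝ) ≠ 0 := NeZero.ne _
  have h := fits_coeff hz le_rfl (by lia) hb
  have hsum : ∑ l ∈ Finset.range (1 + 1), coeff z l * coeff z (1 - l) * rootW N L ^ (l * 0) =
      2 * (coeff z 0 * coeff z 1) := by
    simp only [Finset.sum_range_succ, Finset.sum_range_zero]
    norm_num
    ring
  rw [Fits, hsum, norm_mul, norm_mul, Complex.norm_ofNat] at h
  rw [h]
  field_simp

lemma sqrt_half_add_abs_sub {q r : ℝ} (hr : 0 ≤ r) (hrq : q ^ 2 ≤ r ^ 2) :
    √((r ^ 2 + q ^ 2 + |r ^ 2 - q ^ 2|) / 2) = r := by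
  rw [abs_of_nonneg (sub_nonneg.mpr hrq), add_add_sub_cancel, ← two_mul,
    mul_div_cancel_left₀ _ two_ne_zero, Real.sqrt_sq hr]

lemma sqrt_half_sub_abs_sub {q r : ℝ} (hr : 0 ≤ r) (hrq : r ^ 2 ≤ q ^ 2) :
    √((r ^ 2 + q ^ 2 - |r ^ 2 - q ^ 2|) / 2) = r := by
  rw [abs_of_nonpos (sub_nonpos.mpr hrq), sub_neg_eq_add, add_add_sub_cancel, ← two_mul,
    mul_div_cancel_left₀ _ two_ne_zero, Real.sqrt_sq hr]

theorem firstEntry_eq (hI : I.Admissible N L) (hN : Even N) (hN4 : 4 ≤ N) (hL : Odd L)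
    (hz : IsAnalytic z) (h0 : coeff z 0 ≠ 0) (h1 : coeff z 1 ≠ 0)
    (hb : ∀ p ∈ I.positions N, b p.1 p.2 = measurement L z p.1 p.2) :
    firstEntry N L I b = ‖coeff z 0‖ := by
  set r := ‖coeff z 0‖ with hr
  set q := ‖coeff z (N / 2)‖
  have hr0 : 0 < r := norm_pos_iff.mpr h0
  have hq0 : 0 ≤ q := norm_nonneg _
  have h00 : N * √(b 0 0) = r ^ 2 + q ^ 2 := by
    rw [hb _ (zero_mem_positions zero_le_one), sqrt_measurement_zero hz hN hL, pow_zero, one_mul,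
      abs_of_nonneg (by positivity)]
  have h01 : N * √(b 0 1) = |r ^ 2 - q ^ 2| := by
    rw [hb _ (zero_mem_positions le_rfl), sqrt_measurement_zero hz hN hL, pow_one, neg_one_mul,
      ← sub_eq_add_neg]
  have hfits : ∀ p, Fits N L b (coeff z) 2 (I.i2 p) := fun p =>
    fits_coeff hz one_le_two (by lia) (hb _ (two_mem_positions p))
  unfold firstEntry
  dsimp only
  rw [mul_add, mul_sub, h00, h01, sqrt_measurement_one hz (by lia) (hb _ one_mem_positions)]
  split_ifs with hzero hsol
  · rw [hzero, mul_zero, eq_comm] at h01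
    simpa only [h01, add_zero] using
      sqrt_half_add_abs_sub (q := q) hr0.le (sub_eq_zero.mp (abs_eq_zero.mp h01)).ge
  · refine sqrt_half_add_abs_sub hr0.le (le_of_not_gt fun hlt => ?_)
    obtain ⟨c, hc⟩ := hsol
    have ht₀ : √((r ^ 2 + q ^ 2 + |r ^ 2 - q ^ 2|) / 2) = q := by
      rw [add_comm (r ^ 2), abs_sub_comm]
      exact sqrt_half_add_abs_sub hq0 hlt.le
    rw [ht₀] at hc
    have ht₁ := eq_norm_coeff_one hI (by positivity) hfits hc
    have hrq : r < q := (pow_lt_pow_iff_left₀ hr0.le hq0 two_ne_zero).mp hlt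
    rw [div_eq_iff (by linarith)] at ht₁
    linarith [mul_lt_mul_of_pos_left hrq (norm_pos_iff.mpr h1)]
  · refine sqrt_half_sub_abs_sub hr0.le (le_of_not_gt fun hgt => hsol ?_)
    obtain ⟨s, e, v, hv, hv0, hv1⟩ := exists_isNormalForm hz (by lia) h1
    refine ⟨v 2, fun p => ?_⟩
    rw [sqrt_half_add_abs_sub hr0.le hgt.le, mul_div_cancel_left₀ _ (by positivity), hr, ← hv0,
      ← hv1]
    exact (fits_two_iff v _).mp (hv.fits (by lia) (hfits p))

theorem exists_isNormalForm_isState (hI : I.Admissible N L) (hN : Even N) (hN8 : 8 ≤ N)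
    (hL : Odd L) (hz : IsAnalytic z) (h0 : coeff z 0 ≠ 0) (h1 : coeff z 1 ≠ 0)
    (hb : ∀ p ∈ I.positions N, b p.1 p.2 = measurement L z p.1 p.2) :
    ∃ s e v, IsNormalForm z s e v ∧ IsState N L I b (N / 2) v := by
  obtain ⟨s, e, v, hv, hv0, hv1⟩ := exists_isNormalForm hz (by lia) h1
  have hfirst := firstEntry_eq hI hN (by lia) hL hz h0 h1 hb
  have hfits : ∀ k m, 1 ≤ k → k ≤ N / 2 → (k, m) ∈ I.positions N → Fits N L b v k m :=
    fun k m hk hkN hm => hv.fits hkN (fits_coeff hz hk hkN (hb _ hm))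
  refine ⟨s, e, v, hv, ?_, ?_, ?_, fun _ => ?_, fun j hj hjN p => ?_, hv.tail⟩
  · rw [hv0, hfirst]
  · rw [hv1, sqrt_measurement_one hz (by lia) (hb _ one_mem_positions), hfirst, abs_norm,
      mul_assoc, mul_div_mul_left _ _ two_ne_zero,
      mul_div_cancel_left₀ _ (norm_ne_zero_iff.mpr h0)]
  · exact ⟨hfits 2 0 one_le_two (by lia) (hI.i2_first ▸ two_mem_positions 0),
      hfits 2 _ one_le_two (by lia) (two_mem_positions 1)⟩
  · exact ⟨hfits 3 0 (by lia) (by lia) (three_mem_positions (.inl rfl)),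
      hfits 3 _ (by lia) (by lia) (three_mem_positions (.inr rfl)),
      fun p => hfits 4 _ (by lia) (by lia) (mem_positions_of_four_le le_rfl (by lia) p)⟩
  · exact hfits j _ (by lia) hjN (mem_positions_of_four_le (by lia) hjN p)

end FirstEntry

/-! ### Genericity -/

section PolynomialFunctions

variable {σ : Type*}

/-- Real polynomial functions of the real variables `x i`. -/
@[fun_prop]
def IsPolyFn (f : (σ → ℝ) → ℝ) : Prop := ∃ P : MvPolynomial σ ℝ, ∀ x, MvPolynomial.eval x P = f x

namespace IsPolyFn

variable {f g : (σ → ℝ) → ℝ}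

@[fun_prop]
lemma const (c : ℝ) : IsPolyFn fun _ : σ → ℝ => c :=
  ⟨MvPolynomial.C c, fun _ => MvPolynomial.eval_C c⟩

@[fun_prop]
lemma coord (i : σ) : IsPolyFn fun x : σ → ℝ => x i :=
  ⟨MvPolynomial.X i, fun _ => MvPolynomial.eval_X i⟩

@[fun_prop]
lemma add (hf : IsPolyFn f) (hg : IsPolyFn g) : IsPolyFn fun x => f x + g x := by
  obtain ⟨P, hP⟩ := hf
  obtain ⟨Q, hQ⟩ := hg
  exact ⟨P + Q, fun x => by rw [map_add, hP, hQ]⟩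

@[fun_prop]
lemma mul (hf : IsPolyFn f) (hg : IsPolyFn g) : IsPolyFn fun x => f x * g x := by
  obtain ⟨P, hP⟩ := hf
  obtain ⟨Q, hQ⟩ := hg
  exact ⟨P * Q, fun x => by rw [map_mul, hP, hQ]⟩

@[fun_prop]
lemma neg (hf : IsPolyFn f) : IsPolyFn fun x => -f x := by
  obtain ⟨P, hP⟩ := hf
  exact ⟨-P, fun x => by rw [map_neg, hP]⟩

@[fun_prop]
lemma sub (hf : IsPolyFn f) (hg : IsPolyFn g) : IsPolyFn fun x => f x - g x := by
  simpa only [sub_eq_add_neg] using hf.add hg.neg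

@[fun_prop]
lemma pow (hf : IsPolyFn f) (n : ℕ) : IsPolyFn fun x => f x ^ n := by
  obtain ⟨P, hP⟩ := hf
  exact ⟨P ^ n, fun x => by rw [map_pow, hP]⟩

end IsPolyFn

/-- Complex-valued functions with polynomial real and imaginary parts. -/
@[fun_prop]
structure IsComplexPolyFn (f : (σ → ℝ) → ℂ) : Prop where
  re : IsPolyFn fun x => (f x).re
  im : IsPolyFn fun x => (f x).im

attribute [fun_prop] IsComplexPolyFn.re IsComplexPolyFn.im

@[fun_prop]
lemma IsPolyFn.ofReal {f : (σ → ℝ) → ℝ} (hf : IsPolyFn f) : IsComplexPolyFn fun x => (f x : ℂ) :=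
  ⟨by simpa only [Complex.ofReal_re], by simpa only [Complex.ofReal_im] using .const 0⟩

namespace IsComplexPolyFn

variable {f g : (σ → ℝ) → ℂ}

@[fun_prop]
lemma const (c : ℂ) : IsComplexPolyFn fun _ : σ → ℝ => c :=
  ⟨.const _, .const _⟩

@[fun_prop]
lemma add (hf : IsComplexPolyFn f) (hg : IsComplexPolyFn g) :
    IsComplexPolyFn fun x => f x + g x :=
  ⟨by simp only [Complex.add_re]; fun_prop, by simp only [Complex.add_im]; fun_prop⟩

@[fun_prop]
lemma sub (hf : IsComplexPolyFn f) (hg : IsComplexPolyFn g) :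
    IsComplexPolyFn fun x => f x - g x :=
  ⟨by simp only [Complex.sub_re]; fun_prop, by simp only [Complex.sub_im]; fun_prop⟩

@[fun_prop]
lemma mul (hf : IsComplexPolyFn f) (hg : IsComplexPolyFn g) :
    IsComplexPolyFn fun x => f x * g x :=
  ⟨by simp only [Complex.mul_re]; fun_prop, by simp only [Complex.mul_im]; fun_prop⟩

@[fun_prop]
lemma pow (hf : IsComplexPolyFn f) (n : ℕ) : IsComplexPolyFn fun x => f x ^ n := by
  induction n with
  | zero => simpa only [pow_zero] using .const 1
  | succ n ih => simpa only [pow_succ] using ih.mul hf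

@[fun_prop]
lemma star (hf : IsComplexPolyFn f) : IsComplexPolyFn fun x => conj (f x) :=
  ⟨by simpa only [Complex.conj_re] using hf.re, by simpa only [Complex.conj_im] using hf.im.neg⟩

@[fun_prop]
lemma sum {ι : Type*} {f : ι → (σ → ℝ) → ℂ} (s : Finset ι)
    (hf : ∀ i ∈ s, IsComplexPolyFn (f i)) : IsComplexPolyFn fun x => ∑ i ∈ s, f i x := by
  classical
  induction s using Finset.induction_on with
  | empty => simpa only [Finset.sum_empty] using .const 0
  | insert i s hi ih =>
    simp only [Finset.sum_insert hi]
    exact (hf i (Finset.mem_insert_self i s)).add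
      (ih fun j hj => hf j (Finset.mem_insert_of_mem hj))

@[fun_prop]
lemma normSq (hf : IsComplexPolyFn f) : IsPolyFn fun x => Complex.normSq (f x) := by
  simp only [Complex.normSq_apply]
  fun_prop

end IsComplexPolyFn

/-- Validity outside the zero set of a nonzero real polynomial; `ForGenericAnalytic N Q` is
`Generic fun x => Q (analyticSignal x)`. -/
def Generic (Q : (σ → ℝ) → Prop) : Prop :=
  ∃ P : MvPolynomial σ ℝ, P ≠ 0 ∧ ∀ x, MvPolynomial.eval x P ≠ 0 → Q x

lemma Generic.mono {Q Q' : (σ → ℝ) → Prop} (h : Generic Q) (hQ : ∀ x, Q x → Q' x) :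
    Generic Q' := by
  obtain ⟨P, hP, h⟩ := h
  exact ⟨P, hP, fun x hx => hQ x (h x hx)⟩

lemma Generic.and {Q Q' : (σ → ℝ) → Prop} (h : Generic Q) (h' : Generic Q') :
    Generic fun x => Q x ∧ Q' x := by
  obtain ⟨P, hP, h⟩ := h
  obtain ⟨P', hP', h'⟩ := h'
  refine ⟨P * P', mul_ne_zero hP hP', fun x hx => ?_⟩
  rw [map_mul] at hx
  exact ⟨h x (left_ne_zero_of_mul hx), h' x (right_ne_zero_of_mul hx)⟩

lemma Generic.forall {ι : Sort*} [Finite ι] {Q : ι → (σ → ℝ) → Prop} (h : ∀ i, Generic (Q i)) :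
    Generic fun x => ∀ i, Q i x := by
  choose P hP h using h
  have := Fintype.ofFinite (PLift ι)
  refine ⟨∏ i : PLift ι, P i.down, Finset.prod_ne_zero_iff.mpr fun i _ => hP _, fun x hx i => ?_⟩
  rw [map_prod, Finset.prod_ne_zero_iff] at hx
  exact h i x (hx ⟨i⟩ (Finset.mem_univ _))

lemma IsPolyFn.generic_ne_zero {f : (σ → ℝ) → ℝ} (hf : IsPolyFn f) {x : σ → ℝ} (hx : f x ≠ 0) :
    Generic fun x => f x ≠ 0 := by
  obtain ⟨P, hP⟩ := hf
  refine ⟨P, ?_, fun y hy => by rwa [hP] at hy⟩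
  rintro rfl
  exact hx (by rw [← hP, map_zero])

lemma IsComplexPolyFn.generic_ne_zero {f : (σ → ℝ) → ℂ} (hf : IsComplexPolyFn f) {x : σ → ℝ}
    (hx : f x ≠ 0) : Generic fun x => f x ≠ 0 :=
  (hf.normSq.generic_ne_zero (mt Complex.normSq_eq_zero.mp hx)).mono fun _ =>
    mt Complex.normSq_eq_zero.mpr

end PolynomialFunctions

section GenericSpectra

variable {N L : ℕ} [NeZero N]

@[fun_prop]
lemma isComplexPolyFn_coeff (k : ℕ) :
    IsComplexPolyFn fun x : ZMod N → ℝ => coeff (analyticSignal x) k := by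
  simp only [coeff, analyticSignal, LinearEquiv.apply_symm_apply]
  simp only [dft_apply, smul_eq_mul]
  fun_prop

lemma isComplexPolyFn_crossTerm (k : ℕ) (o : ℂ) :
    IsComplexPolyFn fun x : ZMod N → ℝ => crossTerm (coeff (analyticSignal x)) k o := by
  unfold crossTerm
  fun_prop

lemma isPolyFn_spread (k : ℕ) (o : Fin 3 → ℂ) :
    IsPolyFn fun x : ZMod N → ℝ => spread (coeff (analyticSignal x)) k o :=
  have h (p : Fin 3) := isComplexPolyFn_crossTerm (N := N) k (o p)
  (((h 1).sub (h 0)).mul ((h 2).sub (h 0)).star).im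

lemma isPolyFn_excluder {σ : Type*} (f : Fin 3 → ℝ) {S T Y : (σ → ℝ) → ℂ} {C : (σ → ℝ) → ℝ}
    (hS : IsComplexPolyFn S) (hT : IsComplexPolyFn T) (hY : IsComplexPolyFn Y) (hC : IsPolyFn C) :
    IsPolyFn fun x => excluder f (S x) (T x) (Y x) (C x) := by
  unfold excluder
  fun_prop

lemma isPolyFn_spectrumExcluder (o : Fin 3 → ℂ) :
    IsPolyFn fun x : ZMod N → ℝ => spectrumExcluder o (coeff (analyticSignal x)) := by
  unfold spectrumExcluder innerInvariant reflectedInvariant outerInvariant middleInvariant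
  apply isPolyFn_excluder <;> fun_prop

lemma exists_isModulation_coeff {a : ℕ → ℂ} (h0 : conj (a 0) = a 0)
    (hhalf : conj (a (N / 2)) = a (N / 2)) :
    ∃ x : ZMod N → ℝ, IsModulation (N / 2) 1 1 a (coeff (analyticSignal x)) := by
  let A : ZMod N → ℂ := fun k => if k.val ≤ N / 2 then a k.val else 0
  have hA : IsAnalyticSpectrum (dft (dft.symm A)) := by
    rw [LinearEquiv.apply_symm_apply]
    refine ⟨?_, fun k hk => ?_, fun k hk => if_neg (by lia)⟩
    · simpa [A] using h0
    · simp only [A, show k.val = N / 2 by lia, le_refl, if_true, hhalf]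
  refine ⟨fun n => (dft.symm A n).re, .inl rfl, norm_one, fun k hk => ?_⟩
  have hkN : k < N := hk.trans_lt (Nat.div_lt_self (NeZero.pos N) one_lt_two)
  rw [analyticSignal_re hA, coeff, LinearEquiv.apply_symm_apply, one_mul, one_pow, mul_one]
  simp only [A, ZMod.val_cast_of_lt hkN, hk, if_true]

lemma generic_coeff_ne_zero {k : ℕ} (hk : k ≤ N / 2) :
    Generic fun x : ZMod N → ℝ => coeff (analyticSignal x) k ≠ 0 := by
  obtain ⟨x, hx⟩ := exists_isModulation_coeff (N := N) (a := fun _ => 1) (map_one _) (map_one _)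
  exact (isComplexPolyFn_coeff k).generic_ne_zero (hx.entry_ne_zero hk one_ne_zero)

lemma exists_mul_eq_of_symm {k : ℕ} {x : ℕ → ℂ} (hx : ∀ l ≤ k, x (k - l) = x l) :
    ∃ a : ℕ → ℂ, (∀ l ∉ Finset.Ico 1 k, a l = 0) ∧
      ∀ l ∈ Finset.Ico 1 k, a l * a (k - l) = x l := by
  refine ⟨fun l => if l ∈ Finset.Ico 1 k then x l ^ (((2 : ℕ) : ℂ)⁻¹) else 0,
    fun l hl => if_neg hl, fun l hl => ?_⟩
  have hl' : k - l ∈ Finset.Ico 1 k := by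
    rw [Finset.mem_Ico] at hl ⊢
    lia
  simp only [if_pos hl, if_pos hl', hx l (Finset.mem_Ico.mp hl).2.le, ← sq]
  exact Complex.cpow_nat_inv_pow _ two_ne_zero

lemma sum_mul_sq_ne_sum_sq_mul_sum_sq {ι : Type*} {s : Finset ι} {d e : ι → ℝ}
    (h : ∀ p q : ℝ, (∀ l ∈ s, p * d l + q * e l = 0) → p = 0 ∧ q = 0) :
    (∑ l ∈ s, d l * e l) ^ 2 ≠ (∑ l ∈ s, d l ^ 2) * ∑ l ∈ s, e l ^ 2 := by
  set D := ∑ l ∈ s, d l ^ 2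
  set E := ∑ l ∈ s, e l ^ 2
  set G := ∑ l ∈ s, d l * e l
  intro hGram
  have hsum : ∑ l ∈ s, (-G * d l + D * e l) ^ 2 = 0 := by
    calc ∑ l ∈ s, (-G * d l + D * e l) ^ 2
        = ∑ l ∈ s, (G ^ 2 * d l ^ 2 - 2 * G * D * (d l * e l) + D ^ 2 * e l ^ 2) :=
          Finset.sum_congr rfl fun l _ => by ring
      _ = G ^ 2 * D - 2 * G * D * G + D ^ 2 * E := by
          rw [Finset.sum_add_distrib, Finset.sum_sub_distrib, ← Finset.mul_sum, ← Finset.mul_sum,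
            ← Finset.mul_sum]
      _ = 0 := by linear_combination (-D) * hGram
  have hD0 : D = 0 := (h (-G) D fun l hl =>
    sq_eq_zero_iff.mp ((Finset.sum_eq_zero_iff_of_nonneg fun _ _ => sq_nonneg _).mp hsum l hl)).2
  have hd (l : ι) (hl : l ∈ s) : d l = 0 :=
    sq_eq_zero_iff.mp ((Finset.sum_eq_zero_iff_of_nonneg fun _ _ => sq_nonneg _).mp hD0 l hl)
  exact one_ne_zero (h 1 0 fun l hl => by rw [hd l hl, mul_zero, zero_mul, add_zero]).1

variable {k : ℕ} {o : Fin 3 → ℂ}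

lemma IsSeparated.eq_zero_of_cosRatio_sub (ho : IsSeparated k o) (hk : 4 ≤ k) {p q : ℝ}
    (h : ∀ l ∈ Finset.Ico 1 k, p * (cosRatio k l (o 1) - cosRatio k l (o 0)) +
      q * (cosRatio k l (o 2) - cosRatio k l (o 0)) = 0) : p = 0 ∧ q = 0 := by
  have hcoeffs : ![-p - q, p, q] = 0 := by
    refine ho.eq_zero_of_sum_cosRatio_eq_zero (by lia) fun l hl => ?_
    simp only [Fin.sum_univ_three, Matrix.cons_val]
    obtain rfl | hl0 := Nat.eq_zero_or_pos l
    · simp only [cosRatio_zero (ho.pow_ne _)]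
      ring
    obtain rfl | hlk := hl.eq_or_lt
    · simp only [cosRatio_self (ho.pow_ne _)]
      ring
    linear_combination h l (Finset.mem_Ico.mpr ⟨hl0, hlk⟩)
  exact ⟨congrFun hcoeffs 1, congrFun hcoeffs 2⟩

/- With `a l * a (k - l) = d l + e l * I`, where `d` and `e` are the differences of the cosine
ratios, the spread is minus the Gram determinant of `d` and `e`. -/
lemma IsSeparated.exists_spread_ne_zero (ho : IsSeparated k o) (hk : 4 ≤ k) :
    ∃ a : ℕ → ℂ, (∀ l ∉ Finset.Ico 1 k, a l = 0) ∧ spread a k o ≠ 0 := by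
  let d (l : ℕ) : ℝ := cosRatio k l (o 1) - cosRatio k l (o 0)
  let e (l : ℕ) : ℝ := cosRatio k l (o 2) - cosRatio k l (o 0)
  obtain ⟨a, ha, hmul⟩ := exists_mul_eq_of_symm (k := k) (x := fun l => d l + e l * Complex.I)
    fun l hl => by simp only [d, e, cosRatio_symm hl]
  refine ⟨a, ha, ?_⟩
  have hsub (p : Fin 3) : crossTerm a k (o p) - crossTerm a k (o 0) =
      ∑ l ∈ Finset.Ico 1 k, (d l + e l * Complex.I) *
        ((cosRatio k l (o p) - cosRatio k l (o 0) : ℝ) : ℂ) := by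
    rw [crossTerm, crossTerm, ← Finset.sum_sub_distrib]
    refine Finset.sum_congr rfl fun l hl => ?_
    rw [← hmul l hl]
    push_cast
    ring
  have hspread : spread a k o = (∑ l ∈ Finset.Ico 1 k, d l * e l) ^ 2 -
      (∑ l ∈ Finset.Ico 1 k, d l ^ 2) * ∑ l ∈ Finset.Ico 1 k, e l ^ 2 := by
    rw [spread, hsub, hsub]
    simp only [Complex.mul_im, Complex.conj_re, Complex.conj_im, Complex.re_sum, Complex.im_sum,
      Complex.mul_re, Complex.add_re, Complex.add_im, Complex.ofReal_re, Complex.ofReal_im,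
      Complex.I_re, Complex.I_im, mul_zero, mul_one, sub_zero, add_zero, zero_add]
    simp only [d, e, mul_comm, ← sq]
    ring
  rw [hspread]
  exact sub_ne_zero.mpr (sum_mul_sq_ne_sum_sq_mul_sum_sq fun p q h =>
    ho.eq_zero_of_cosRatio_sub hk h)

lemma exists_spectrumExcluder_ne_zero (o : Fin 3 → ℂ) :
    ∃ a : ℕ → ℂ, (∀ j ≠ 2, conj (a j) = a j) ∧ spectrumExcluder o a ≠ 0 := by
  set f := productCoeffs o with hf
  let t : ℝ := f 1 / 2 - f 2 + 1
  let a : ℕ → ℂ := fun j => if j = 2 then Complex.I else if j = 4 then (t : ℂ) else 1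
  have hval : spectrumExcluder o a = (8 * t - 4 * f 1 + 8 * f 2) ^ 2 := by
    simp [spectrumExcluder, excluder, innerInvariant, reflectedInvariant, outerInvariant,
      middleInvariant, a, ← hf]
    ring
  refine ⟨a, fun j hj => ?_, ?_⟩
  · simp only [a, if_neg hj]
    split_ifs
    · exact Complex.conj_ofReal t
    · exact map_one _
  · rw [hval, show 8 * t - 4 * f 1 + 8 * f 2 = 8 by ring]
    norm_num

lemma generic_spread_ne_zero (ho : IsSeparated k o) (hk : 4 ≤ k) (hkN : k ≤ N / 2) :
    Generic fun x : ZMod N → ℝ => spread (coeff (analyticSignal x)) k o ≠ 0 := by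
  obtain ⟨a, ha, hspread⟩ := ho.exists_spread_ne_zero hk
  have hreal (l : ℕ) (hl : l ∉ Finset.Ico 1 k) : conj (a l) = a l := by rw [ha l hl, map_zero]
  obtain ⟨x, hx⟩ := exists_isModulation_coeff (N := N) (hreal 0 (by simp)) (hreal _ (by simp; lia))
  exact (isPolyFn_spread k o).generic_ne_zero (x := x) (by rwa [hx.spread_eq hkN])

lemma generic_spectrumExcluder_ne_zero (o : Fin 3 → ℂ) (hN : 8 ≤ N) :
    Generic fun x : ZMod N → ℝ => spectrumExcluder o (coeff (analyticSignal x)) ≠ 0 := by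
  obtain ⟨a, ha, hexcluder⟩ := exists_spectrumExcluder_ne_zero o
  obtain ⟨x, hx⟩ := exists_isModulation_coeff (N := N) (ha 0 (by lia)) (ha _ (by lia))
  refine (isPolyFn_spectrumExcluder o).generic_ne_zero (x := x) ?_
  rwa [IsModulation.spectrumExcluder_eq (hx.mono (by lia))]

theorem generic_nonDegenerate (hN : 8 ≤ N) :
    Generic fun x : ZMod N → ℝ => NonDegenerate N L (coeff (analyticSignal x)) := by
  have hspread := Generic.forall fun k : Finset.Icc 4 (N / 2) => Generic.forall
    fun m : Fin 3 → Fin (numShifts N L) => Generic.forall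
      fun ho : IsSeparated k (fun p => rootW N L ^ (m p : ℕ)) =>
        generic_spread_ne_zero (N := N) ho (Finset.mem_Icc.mp k.2).1 (Finset.mem_Icc.mp k.2).2
  have hexcluder := Generic.forall fun m : Fin 3 → Fin (numShifts N L) =>
    generic_spectrumExcluder_ne_zero (fun p => rootW N L ^ (m p : ℕ)) hN
  have hcoeff (k : ℕ) (hk : k ≤ N / 2) := generic_coeff_ne_zero (N := N) hk
  refine ((((hcoeff 0 (by lia)).and (hcoeff 1 (by lia))).and ((hcoeff 2 (by lia)).and
    (hcoeff (N / 2) le_rfl))).and (hspread.and hexcluder)).mono ?_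
  rintro x ⟨⟨⟨h0, h1⟩, h2, hhalf⟩, hspread, hexcluder⟩
  exact ⟨h0, h1, h2, hhalf, fun k hk => hspread ⟨k, hk⟩, fun m _ => hexcluder m⟩

end GenericSpectra

/-! ### Recovery -/

section Positions

variable {N L : ℕ} {I : Shifts}

lemma card_image_prodMk {ι : Type*} [Fintype ι] {g : ι → ℕ} (hg : Function.Injective g) (k : ℕ) :
    (Finset.univ.image fun p => (k, g p)).card = Fintype.card ι :=
  Finset.card_image_of_injective _ ((Prod.mk_right_injective k).comp hg)

lemma Shifts.Admissible.card_biUnion_image_ik (hI : I.Admissible N L) :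
    ((Finset.Icc 4 (N / 2)).biUnion
      fun k => Finset.univ.image fun p : Fin 3 => (k, I.ik k p)).card = 3 * (N / 2 - 3) := by
  have hcard (k : ℕ) (hk : k ∈ Finset.Icc 4 (N / 2)) :
      (Finset.univ.image fun p : Fin 3 => (k, I.ik k p)).card = 3 := by
    obtain ⟨h4, hkN⟩ := Finset.mem_Icc.mp hk
    exact card_image_prodMk (hI.ik_injective k h4 hkN) k
  rw [Finset.card_biUnion, Finset.sum_congr rfl hcard, Finset.sum_const, Nat.card_Icc, smul_eq_mul]
  · lia
  · intro k _ k' _ hkk'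
    rw [Function.onFun, Finset.disjoint_left]
    grind

theorem Shifts.Admissible.card_positions (hI : I.Admissible N L) (hN : Even N) (hN8 : 8 ≤ N) :
    (I.positions N).card = 3 * N / 2 + 1 := by
  have h0 : ({(0, 0), (0, 1), (1, 0)} : Finset (ℕ × ℕ)).card = 3 := rfl
  have h3 : ({(3, 0), (3, I.i3)} : Finset (ℕ × ℕ)).card = 2 :=
    Finset.card_pair ((Prod.mk_right_injective 3).ne (Nat.ne_of_lt hI.i3_pos))
  rw [Shifts.positions, Finset.card_union_of_disjoint, Finset.card_union_of_disjoint,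
    Finset.card_union_of_disjoint, h0, card_image_prodMk hI.i2_injective, Fintype.card_fin, h3,
    hI.card_biUnion_image_ik]
  · grind
  all_goals
    simp only [Finset.disjoint_left, Finset.mem_union, Finset.mem_insert, Finset.mem_singleton,
      Finset.mem_biUnion, Finset.mem_Icc, Finset.mem_image, Finset.mem_univ, true_and]
    grind

lemma Shifts.Admissible.positions_lt (hI : I.Admissible N L) (hN : 8 ≤ N) {x : ℕ × ℕ}
    (hx : x ∈ I.positions N) : x.1 < N ∧ x.2 < numShifts N L := by
  have h3 := hI.i3_pos
  have h3r := hI.i3_lt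
  have h2r := hI.i2_lt
  have hkr := hI.ik_lt
  simp only [Shifts.positions, Finset.mem_union, Finset.mem_insert, Finset.mem_singleton,
    Finset.mem_biUnion, Finset.mem_Icc, Finset.mem_image, Finset.mem_univ, true_and] at hx
  obtain (((rfl | rfl | rfl) | ⟨q, rfl⟩) | rfl | rfl) | ⟨k, ⟨h4, hk⟩, p, rfl⟩ := hx <;>
    grind

end Positions

section Recovery

variable {N L : ℕ} [NeZero N] {I : Shifts} {z : ZMod N → ℂ}

lemma exists_isNormalForm_of_isState {b : ℕ → ℕ → ℝ} (hI : I.Admissible N L) (hN : Even N)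
    (hN8 : 8 ≤ N) (hL : Odd L) (hz : IsAnalytic z) (hnd : NonDegenerate N L (coeff z))
    (hb : ∀ p ∈ I.positions N, b p.1 p.2 = measurement L z p.1 p.2) {u : ℕ → ℂ}
    (hu : IsState N L I b (N / 2) u) :
    ∃ s e v, IsNormalForm z s e v ∧ v (N / 2) ≠ 0 ∧ (u = v ∨ u = fun j => conj (v j)) := by
  obtain ⟨s, e, v, hv, hstate⟩ :=
    exists_isNormalForm_isState hI hN hN8 hL hz hnd.zero_ne_zero hnd.one_ne_zero hb
  have hvnd := hv.nonDegenerate hN8 hnd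
  exact ⟨s, e, v, hv, hvnd.half_ne_zero,
    (hu.agree_or_agree_conj hI hN8 (by lia) le_rfl hstate hvnd).imp
      (hu.eq_of_agree hstate) (hu.eq_of_agree hstate.conj)⟩

theorem finalSignal_sameUpToAmbiguity {b : ℕ → ℕ → ℝ} (hI : I.Admissible N L) (hN : Even N)
    (hN8 : 8 ≤ N) (hL : Odd L) (hz : IsAnalytic z) (hnd : NonDegenerate N L (coeff z))
    (hb : ∀ p ∈ I.positions N, b p.1 p.2 = measurement L z p.1 p.2) {u : ℕ → ℂ}
    (hu : IsState N L I b (N / 2) u) : SameUpToAmbiguity (finalSignal N u) z := by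
  obtain ⟨s, e, v, hv, hhalf, rfl | rfl⟩ :=
    exists_isNormalForm_of_isState hI hN hN8 hL hz hnd hb hu
  · exact hv.finalSignal_sameUpToAmbiguity hz hN hhalf
  · have hreflect : SameUpToAmbiguity (reflect z) z :=
      ⟨1, 0, .inl rfl, .inr (by rw [translate_zero, one_smul])⟩
    exact (hv.conj.finalSignal_sameUpToAmbiguity hz.reflect hN
      ((map_ne_zero _).mpr hhalf)).trans hreflect

theorem sameUpToAmbiguity_of_measurement_eq (hI : I.Admissible N L) (hN : Even N) (hN8 : 8 ≤ N)
    (hL : Odd L) (hz : IsAnalytic z) (hnd : NonDegenerate N L (coeff z)) {z' : ZMod N → ℂ}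
    (hz' : IsAnalytic z')
    (h : ∀ p ∈ I.positions N, measurement L z' p.1 p.2 = measurement L z p.1 p.2) :
    SameUpToAmbiguity z' z := by
  have hb : ∀ p ∈ I.positions N, measurement L z p.1 p.2 = measurement L z' p.1 p.2 :=
    fun p hp => (h p hp).symm
  have hprod : 2 * ‖coeff z' 0‖ * ‖coeff z' 1‖ = 2 * ‖coeff z 0‖ * ‖coeff z 1‖ := by
    rw [← sqrt_measurement_one hz (by lia) rfl,
      ← sqrt_measurement_one hz' (by lia) (hb _ one_mem_positions)]
  have hne : 2 * ‖coeff z' 0‖ * ‖coeff z' 1‖ ≠ 0 := by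
    have h0 := norm_ne_zero_iff.mpr hnd.zero_ne_zero
    have h1 := norm_ne_zero_iff.mpr hnd.one_ne_zero
    rw [hprod]
    positivity
  obtain ⟨s, e, v, hv, hstate⟩ := exists_isNormalForm_isState hI hN hN8 hL hz'
    (norm_ne_zero_iff.mp (right_ne_zero_of_mul (left_ne_zero_of_mul hne)))
    (norm_ne_zero_iff.mp (right_ne_zero_of_mul hne)) hb
  have hhalf : v (N / 2) ≠ 0 := by
    obtain ⟨_, _, v', _, hhalf, rfl | rfl⟩ :=
      exists_isNormalForm_of_isState hI hN hN8 hL hz hnd (fun _ _ => rfl) hstate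
    · exact hhalf
    · exact (map_ne_zero _).mpr hhalf
  exact (hv.finalSignal_sameUpToAmbiguity hz' hN hhalf).symm.trans
    (finalSignal_sameUpToAmbiguity hI hN hN8 hL hz hnd (fun _ _ => rfl) hstate)

theorem isAnalytic_and_measurement_eq_iff (hI : I.Admissible N L) (hN : Even N) (hN8 : 8 ≤ N)
    (hL : Odd L) (hz : IsAnalytic z) (hnd : NonDegenerate N L (coeff z)) {o : ZMod N → ℂ}
    (ho : SameUpToAmbiguity o z) (z' : ZMod N → ℂ) :
    (IsAnalytic z' ∧ ∀ k < N, ∀ m < numShifts N L, measurement L z' k m = measurement L z k m) ↔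
      SameUpToAmbiguity z' o := by
  refine ⟨fun ⟨hz', h⟩ => ?_, fun h => ?_⟩
  · have hprescribed : ∀ p ∈ I.positions N,
        measurement L z' p.1 p.2 = measurement L z p.1 p.2 := fun p hp =>
      h _ (hI.positions_lt hN8 hp).1 _ (hI.positions_lt hN8 hp).2
    exact (sameUpToAmbiguity_of_measurement_eq hI hN hN8 hL hz hnd hz' hprescribed).trans ho.symm
  · exact ⟨(h.trans ho).isAnalytic hz, fun k _ m _ => (h.trans ho).measurement_eq L k m⟩

end Recovery

end FROG

end

theorem theorem3p9 (N L : ℕ) [NeZero N] (hN : Even N) (hN8 : 8 ≤ N) (hL : Odd L)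
    (hr : 5 ≤ FROG.numShifts N L) :
    -- the prescribed measurements are `3N/2 + 1` in number
    (∀ I : FROG.Shifts, I.Admissible N L → (I.positions N).card = 3 * N / 2 + 1) ∧
    FROG.ForGenericAnalytic N (fun z : ZMod N → ℂ =>
      ZMod.dft z 0 ≠ 0 → ZMod.dft z 1 ≠ 0 →
      ∀ I : FROG.Shifts, I.Admissible N L →
        -- the algorithm, run on data of which only the prescribed measurements of `z` are known
        (∀ b : ℕ → ℕ → ℝ,
          (∀ p ∈ I.positions N, b p.1 p.2 = FROG.measurement L z p.1 p.2) →
          -- it can be started, and after any choice of `u_2` it runs to the end in one way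
          (∃ u : ℕ → ℂ, FROG.IsState N L I b 2 u) ∧
          (∀ n : ℕ, 2 ≤ n → n ≠ 3 → n ≤ N / 2 → ∀ u : ℕ → ℂ, FROG.IsState N L I b n u →
            ∃! v : ℕ → ℂ, FROG.IsState N L I b (N / 2) v ∧ ∀ j ≤ n, v j = u j) ∧
          -- every output is `z` up to the ambiguity, and the analytic signals with the same FROG
          -- measurements as `z` are exactly the output up to the ambiguity
          (∀ o : ZMod N → ℂ, FROG.IsOutput N L I b o →
            FROG.SameUpToAmbiguity o z ∧
            ∀ z' : ZMod N → ℂ,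
              (FROG.IsAnalytic z' ∧ ∀ k < N, ∀ m < FROG.numShifts N L,
                FROG.measurement L z' k m = FROG.measurement L z k m) ↔
              FROG.SameUpToAmbiguity z' o)) ∧
        -- `z` is determined up to the ambiguity by its prescribed measurements
        (∀ z' : ZMod N → ℂ, FROG.IsAnalytic z' →
          (∀ p ∈ I.positions N, FROG.measurement L z' p.1 p.2 = FROG.measurement L z p.1 p.2) →
          FROG.SameUpToAmbiguity z' z)) := by
  refine ⟨fun I hI => hI.card_positions hN hN8,
    (FROG.generic_nonDegenerate (L := L) hN8).mono fun x hnd _ _ I hI => ⟨fun b hb => ?_, ?_⟩⟩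
  all_goals have hz : FROG.IsAnalytic (FROG.analyticSignal x) := ⟨x, rfl⟩
  · obtain ⟨s, e, v, hv, hstate⟩ := FROG.exists_isNormalForm_isState hI hN hN8 hL hz
      hnd.zero_ne_zero hnd.one_ne_zero hb
    refine ⟨⟨_, hstate.truncate le_rfl (by lia)⟩, fun n hn hn3 hnN u hu => ?_, ?_⟩
    · exact hu.existsUnique_extension hI hN8 hn hn3 hnN hstate (hv.nonDegenerate hN8 hnd)
    · rintro o ⟨u, hu, rfl⟩
      have ho := FROG.finalSignal_sameUpToAmbiguity hI hN hN8 hL hz hnd hb hu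
      exact ⟨ho, FROG.isAnalytic_and_measurement_eq_iff hI hN hN8 hL hz hnd ho⟩
  · exact fun z' => FROG.sameUpToAmbiguity_of_measurement_eq hI hN hN8 hL hz hnd
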